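/- Graphs are finite, simple and undirected. A \emph{geometric graph} is a graph $G$ whose vertices are distinct points in the plane and in which each edge $vw$ is the straight line segment between $v$ and $w$, such that no edge passes through a vertex different from its endpoints, any two edges intersect in finitely many points, and no three edges internally intersect at a common point. It is a \emph{circular graph} if all its vertices lie on a circle. A \emph{crossing} of two distinct edges is a point interior to both; two edges \emph{cross} if they have a crossing. For an integer $c \geqslant 1$, an \emph{ordered $c$-edge-colouring} is a function $\phi : E(G) \to \{1,\dots,c\}$; it is \emph{transparent} if no two edges of the same colour cross. The \emph{fragments} of an edge $e$ are the subsegments into which $e$ is split by its crossings with the edges of colour less than $\phi(e)$; an edge $f$ \emph{crosses} a fragment $\gamma$ of $e$ if some crossing of $e$ and $f$ lies on $\gamma$. The \emph{matching number} of a set of edges is the maximum size of a subset of pairwise disjoint edges. The \emph{treewidth} $\mathrm{tw}(G)$ is the minimum, over all tree decompositions of $G$, of the maximum bag size minus one. \textbf{Theorem.} Let $c \geqslant 1$ and $m \geqslant 0$ be integers, and let $G$ be a circular graph with a transparent ordered $c$-edge-colouring $\phi$. Suppose that for all $i, j \in \{1,\dots,c\}$ with $i < j$, for every edge $e$ of colour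 $i$ and for every fragment $\gamma$ of $e$, the matching number of the set of edges of colour $j$ that cross $\gamma$ is at most $m$. Then $$\mathrm{tw}(G) \leqslant 9mc(c-1) + 3c - 1.$$ In particular, the same bound holds if for all $i, j \in \{1,\dots,c\}$ with $i < j$ and for every edge $e$ of colour $i$, the matching number of the set of edges of colour $j$ that cross $e$ is at most $m$. -/

import Mathlib

/-- A tree decomposition of a graph `G`: a (finite) tree whose nodes carry bags of vertices of `G`,
such that both ends of every edge lie in a common bag, and for every vertex `v` the nodes whose bag
contains `v` induce a non-empty connected subtree.
(In Mathlib, `SimpleGraph.Connected` and `SimpleGraph.IsTree` include non-emptiness.) -/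
structure TreeDecomposition {V : Type*} (G : SimpleGraph V) where
  Node : Type
  [fintypeNode : Fintype Node]
  tree : SimpleGraph Node
  isTree : tree.IsTree
  bag : Node → Finset V
  exists_bag_of_adj : ∀ v w : V, G.Adj v w → ∃ t, v ∈ bag t ∧ w ∈ bag t
  connected_of_vertex : ∀ v : V, (tree.induce {t | v ∈ bag t}).Connected

attribute [instance] TreeDecomposition.fintypeNode

/-- The width of a tree decomposition: the maximum size of a bag, minus one. -/
def TreeDecomposition.width {V : Type*} {G : SimpleGraph V} (D : TreeDecomposition G) : ℤ :=
  ((Finset.univ.sup fun t => (D.bag t).card : ℕ) : ℤ) - 1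

/-- The treewidth of a graph: the minimum width of a tree decomposition. (All widths are at least
`-1`, and a finite graph has the tree decomposition with a single bag, so for finite graphs this
infimum is a minimum. It is `-1` for the graph without vertices.) -/
noncomputable def treewidth {V : Type*} (G : SimpleGraph V) : ℤ :=
  sInf (Set.range fun D : TreeDecomposition G => D.width)

/-- A matching is a set of pairwise disjoint edges. -/
def IsEdgeMatching {V : Type*} {G : SimpleGraph V} (M : Set G.edgeSet) : Prop :=
  ∀ e ∈ M, ∀ f ∈ M, e ≠ f → ∀ v : V, ¬ (v ∈ (e : Sym2 V) ∧ v ∈ (f : Sym2 V))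

/-- The matching number of a set `E` of edges of `G`: the size of the largest matching in `G` that
consists of edges in `E`. -/
noncomputable def matchingNumber {V : Type*} {G : SimpleGraph V} (E : Set G.edgeSet) : ℕ∞ :=
  ⨆ (M : Set G.edgeSet) (_ : M ⊆ E ∧ IsEdgeMatching M), M.encard

/-- The Euclidean plane. -/
abbrev Plane : Type := EuclideanSpace ℝ (Fin 2)

/-- The closed straight line segment joining the ends of an unordered pair of points. -/
def closedSeg : Sym2 Plane → Set Plane :=
  Sym2.lift ⟨fun x y => segment ℝ x y, fun x y => segment_symm ℝ x y⟩

/-- The straight line segment joining the ends of an unordered pair of points, without its ends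
(when the two points are distinct). -/
def openSeg : Sym2 Plane → Set Plane :=
  Sym2.lift ⟨fun x y => openSegment ℝ x y, fun x y => openSegment_symm ℝ x y⟩

/-- A geometric graph: a topological graph in which every edge is a straight line segment.
The vertices are distinct points in the plane, each edge `vw` is the segment between `v` and `w`,
no edge passes through any vertex different from its ends, each pair of edges intersects in finitely
many points, and no three edges internally intersect at a common point. -/
structure GeometricGraph (V : Type*) where
  graph : SimpleGraph V
  pos : V → Plane
  pos_injective : Function.Injective pos
  mem_of_pos_mem : ∀ e ∈ graph.edgeSet, ∀ v : V, pos v ∈ closedSeg (e.map pos) → v ∈ e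
  finite_inter : ∀ e ∈ graph.edgeSet, ∀ f ∈ graph.edgeSet, e ≠ f →
    (closedSeg (e.map pos) ∩ closedSeg (f.map pos)).Finite
  no_triple_point : ∀ e ∈ graph.edgeSet, ∀ f ∈ graph.edgeSet, ∀ g ∈ graph.edgeSet,
    e ≠ f → f ≠ g → e ≠ g →
      openSeg (e.map pos) ∩ openSeg (f.map pos) ∩ openSeg (g.map pos) = ∅

namespace GeometricGraph

variable {V : Type*} (G : GeometricGraph V)

/-- A circular graph: a geometric graph with its vertices positioned on a circle. -/
def IsCircular : Prop :=
  ∃ (o : Plane) (r : ℝ), 0 < r ∧ ∀ v, G.pos v ∈ Metric.sphere o r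

/-- The interior of an edge: the segment without the two end vertices. -/
def edgeInterior (e : G.graph.edgeSet) : Set Plane :=
  openSeg ((e : Sym2 V).map G.pos)

/-- The crossings of `e` and `f`: the internal intersection points of the (distinct) edges. -/
def crossings (e f : G.graph.edgeSet) : Set Plane :=
  {x | e ≠ f ∧ x ∈ G.edgeInterior e ∧ x ∈ G.edgeInterior f}

/-- Two edges cross if they have a crossing. -/
def Crosses (e f : G.graph.edgeSet) : Prop :=
  (G.crossings e f).Nonempty

variable {c : ℕ}

/-- An ordered `c`-edge-colouring `φ : E(G) → {1, …, c}` (the colours are indexed here by `Fin c`)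
is transparent if no two edges of the same colour cross. -/
def IsTransparent (φ : G.graph.edgeSet → Fin c) : Prop :=
  ∀ e f : G.graph.edgeSet, φ e = φ f → ¬ G.Crosses e f

/-- The points at which an edge `e` starts, ends, or is split: the positions of its two end
vertices and the crossings of `e` with the edges of colour less than the colour of `e`. -/
def splitPoints (φ : G.graph.edgeSet → Fin c) (e : G.graph.edgeSet) : Set Plane :=
  {x | ∃ v ∈ (e : Sym2 V), x = G.pos v} ∪
    {x | ∃ f : G.graph.edgeSet, φ f < φ e ∧ x ∈ G.crossings e f}

/-- The fragments of an edge `e` are the subcurves into which `e` is split by its crossings with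
the edges of smaller colour, that is, the segments between consecutive split points of `e`. -/
def IsFragment (φ : G.graph.edgeSet → Fin c) (e : G.graph.edgeSet) (γ : Set Plane) : Prop :=
  ∃ p ∈ G.splitPoints φ e, ∃ q ∈ G.splitPoints φ e, p ≠ q ∧
    Disjoint (openSegment ℝ p q) (G.splitPoints φ e) ∧ γ = segment ℝ p q

/-- The edge `f` crosses the fragment `γ` of the edge `e`: some crossing of `e` and `f` is on `γ`.
(For `f` of larger colour than `e`, such a crossing is never an end point of `γ`, since no three
edges internally intersect at a common point.) -/
def CrossesFragment (f e : G.graph.edgeSet) (γ : Set Plane) : Prop :=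
  (G.crossings e f ∩ γ).Nonempty

end GeometricGraph

/-! The proof plays a tree-like way of building `V` off against a tangle-like notion of smallness.
Put `k = 3mc(c-1) + c`, and say that a vertex set has small boundary if at most `k` vertices cover
the edges leaving it. If `V` can be built from subsingletons by disjoint unions with small boundary,
then minimum separations at the nodes of the building nest, by uncrossing, and give a tree
decomposition with bags of size at most `3k` (`Buildable.hasTreeDecomp`). Otherwise
`exists_small_sets` supplies small sets: subsingletons are small, disjoint unions of small sets are
small if their boundary is, every set with small boundary is small or has a small complement, and
`V` is not small.

The second case is refuted geometrically. The chords are drawn one at a time, in order of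
non-decreasing colour, maintaining a closed polygon whose corners lie in a convex part of the disc
on one side of every drawn edge; its sides carry disjoint small arcs of vertices with union `V`. At
the start the corners are the vertices and the arcs are singletons. A new edge cuts the polygon
along pieces of its fragments. The arc cut off has small boundary, so it or its complement is small,
and one of the two parts of the polygon survives (`CornerPath.exists_closed_halfplane`,
`exists_polygon_insert`). Once all edges are drawn, none separates two corners, so the arcs can be
merged one by one and `V` becomes small (`IsSmallSetting.false`).

Boundaries are counted by linking each corner to a vertex through fragments of strictly decreasing
colours. Edges of smaller or equal colour do not cross the interior of a fragment. A fragment of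
colour index `i` therefore costs one end of its own edge plus a cover of size `2m` for each of the
`c-1-i` larger colours. The total is `pathCost c m c = c + mc(c-1)`; two such links cover the
boundary of an arc between two corners. -/

/-! ### Gluing tree decompositions -/

/-- The join of two trees by an edge is a tree. -/
theorem SimpleGraph.IsTree.sum_sup_edge {N₁ N₂ : Type*} [Finite N₁] [Finite N₂]
    {T₁ : SimpleGraph N₁} {T₂ : SimpleGraph N₂} (h₁ : T₁.IsTree) (h₂ : T₂.IsTree)
    (r₁ : N₁) (r₂ : N₂) :
    (T₁.sum T₂ ⊔ SimpleGraph.edge (Sum.inl r₁) (Sum.inr r₂)).IsTree := by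
  rw [SimpleGraph.isTree_iff_connected_and_card] at *
  refine ⟨h₁.1.sum_sup_edge h₂.1, ?_⟩
  have hset : (T₁.sum T₂ ⊔ SimpleGraph.edge (Sum.inl r₁) (Sum.inr r₂)).edgeSet
      = insert s(Sum.inl r₁, Sum.inr r₂) (T₁.sum T₂).edgeSet := by
    rw [SimpleGraph.edgeSet_sup, SimpleGraph.edgeSet_edge_of_ne (by simp), Set.union_comm,
      Set.singleton_union]
  have hnot : s(Sum.inl r₁, Sum.inr r₂) ∉ (T₁.sum T₂).edgeSet := by simp
  rw [hset, Nat.card_coe_set_eq, Set.ncard_insert_of_notMem hnot, ← Nat.card_coe_set_eq,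
    Nat.card_congr SimpleGraph.edgeSetSumEquiv, Nat.card_sum, Nat.card_sum]
  omega

/-- `G` has a tree decomposition, restricted to the vertex set `X`, with bags of size at most `K`,
in which some bag contains `R`. -/
def HasTreeDecomp {V : Type*} (G : SimpleGraph V) (X R : Set V) (K : ℕ) : Prop :=
  ∃ (N : Type) (_ : Finite N) (T : SimpleGraph N) (bag : N → Set V) (r : N),
    T.IsTree ∧ (∀ t, bag t ⊆ X) ∧ (∀ t, (bag t).ncard ≤ K) ∧ R ⊆ bag r ∧
    (∀ v ∈ X, ∀ w ∈ X, G.Adj v w → ∃ t, v ∈ bag t ∧ w ∈ bag t) ∧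
    ∀ v ∈ X, (T.induce {t | v ∈ bag t}).Connected

theorem HasTreeDecomp.single {V : Type*} (G : SimpleGraph V) {X : Set V} {K : ℕ}
    (h : X.ncard ≤ K) : HasTreeDecomp G X X K := by
  refine ⟨Unit, inferInstance, ⊥, fun _ => X, (), SimpleGraph.IsTree.of_subsingleton,
    fun _ => subset_rfl, fun _ => h, subset_rfl, fun v hv w hw _ => ⟨(), hv, hw⟩, fun v hv => ?_⟩
  have : Nonempty {t : Unit | v ∈ X} := ⟨⟨(), hv⟩⟩
  have : Subsingleton {t : Unit | v ∈ X} := ⟨fun a b => Subtype.ext rfl⟩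
  exact SimpleGraph.IsTree.of_subsingleton.1

theorem HasTreeDecomp.mono {V : Type*} {G : SimpleGraph V} {X R R' : Set V} {K : ℕ}
    (h : HasTreeDecomp G X R K) (hR : R' ⊆ R) : HasTreeDecomp G X R' K := by
  obtain ⟨N, i, T, bag, r, h1, h2, h3, h4, h5⟩ := h
  exact ⟨N, i, T, bag, r, h1, h2, h3, hR.trans h4, h5⟩

theorem SimpleGraph.Connected.induce_image {N M : Type*} {T : SimpleGraph N} {T' : SimpleGraph M}
    (f : T ↪g T') {s : Set N} (h : (T.induce s).Connected) : (T'.induce (f '' s)).Connected := by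
  refine (SimpleGraph.Iso.connected_iff (G := T.induce s) (H := T'.induce (f '' s)) ?_).1 h
  exact ⟨Equiv.Set.image f s f.injective, by intro a b; simp⟩

/-- Two tree decompositions can be glued when the common vertices lie in the root bags. -/
theorem HasTreeDecomp.glue {V : Type*} {G : SimpleGraph V} {X₁ X₂ R₁ R₂ : Set V} {K : ℕ}
    (h₁ : HasTreeDecomp G X₁ R₁ K) (h₂ : HasTreeDecomp G X₂ R₂ K)
    (hR₁ : X₁ ∩ X₂ ⊆ R₁) (hR₂ : X₁ ∩ X₂ ⊆ R₂)
    (hadj : ∀ v ∈ X₁ ∪ X₂, ∀ w ∈ X₁ ∪ X₂, G.Adj v w → (v ∈ X₁ ∧ w ∈ X₁) ∨ (v ∈ X₂ ∧ w ∈ X₂)) :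
    HasTreeDecomp G (X₁ ∪ X₂) R₁ K := by
  obtain ⟨N₁, i₁, T₁, b₁, r₁, ht₁, hs₁, hc₁, hr₁, he₁, hv₁⟩ := h₁
  obtain ⟨N₂, i₂, T₂, b₂, r₂, ht₂, hs₂, hc₂, hr₂, he₂, hv₂⟩ := h₂
  set T := T₁.sum T₂ ⊔ SimpleGraph.edge (Sum.inl r₁) (Sum.inr r₂) with hT
  let f₁ : T₁ ↪g T := ⟨⟨Sum.inl, Sum.inl_injective⟩, by
    intro a b; simp [hT, SimpleGraph.edge_adj]⟩
  let f₂ : T₂ ↪g T := ⟨⟨Sum.inr, Sum.inr_injective⟩, by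
    intro a b; simp [hT, SimpleGraph.edge_adj]⟩
  refine ⟨N₁ ⊕ N₂, inferInstance, T, Sum.elim b₁ b₂, Sum.inl r₁, ht₁.sum_sup_edge ht₂ r₁ r₂,
    ?_, ?_, hr₁, ?_, ?_⟩
  · rintro (t | t)
    · exact (hs₁ t).trans Set.subset_union_left
    · exact (hs₂ t).trans Set.subset_union_right
  · rintro (t | t)
    · exact hc₁ t
    · exact hc₂ t
  · intro v hv w hw hvw
    rcases hadj v hv w hw hvw with ⟨a, b⟩ | ⟨a, b⟩
    · obtain ⟨t, ht⟩ := he₁ v a w b hvw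
      exact ⟨Sum.inl t, ht⟩
    · obtain ⟨t, ht⟩ := he₂ v a w b hvw
      exact ⟨Sum.inr t, ht⟩
  · intro v hv
    have hsplit : {t | v ∈ Sum.elim b₁ b₂ t} = f₁ '' {t | v ∈ b₁ t} ∪ f₂ '' {t | v ∈ b₂ t} := by
      ext (t | t) <;> simp [f₁, f₂]
    rw [hsplit]
    by_cases hv1 : v ∈ X₁
    · by_cases hv2 : v ∈ X₂
      · have c₁ := (hv₁ v hv1).induce_image f₁
        have c₂ := (hv₂ v hv2).induce_image f₂
        exact SimpleGraph.connected_induce_union (v := f₁ r₁) (w := f₂ r₂)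
          c₁.preconnected c₂.preconnected
          ⟨r₁, hr₁ (hR₁ ⟨hv1, hv2⟩), rfl⟩ ⟨r₂, hr₂ (hR₂ ⟨hv1, hv2⟩), rfl⟩
          (by simp [f₁, f₂, hT, SimpleGraph.edge_adj])
      · have : {t | v ∈ b₂ t} = ∅ := by
          ext t; simpa using fun h => hv2 (hs₂ t h)
        rw [this, Set.image_empty, Set.union_empty]
        exact (hv₁ v hv1).induce_image f₁
    · have hv2 : v ∈ X₂ := hv.resolve_left hv1
      have : {t | v ∈ b₁ t} = ∅ := by
        ext t; simpa using fun h => hv1 (hs₁ t h)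
      rw [this, Set.image_empty, Set.empty_union]
      exact (hv₂ v hv2).induce_image f₂

theorem TreeDecomposition.neg_one_le_width {V : Type*} {G : SimpleGraph V}
    (D : TreeDecomposition G) : -1 ≤ D.width := by
  unfold TreeDecomposition.width
  omega

theorem treewidth_le_of_hasTreeDecomp {V : Type*} [Finite V] {G : SimpleGraph V} {R : Set V} {K : ℕ}
    (h : HasTreeDecomp G Set.univ R K) : treewidth G ≤ (K : ℤ) - 1 := by
  obtain ⟨N, i, T, bag, r, ht, -, hc, -, he, hv⟩ := h
  have := Fintype.ofFinite N
  let D : TreeDecomposition G :=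
    { Node := N
      tree := T
      isTree := ht
      bag := fun t => (Set.toFinite (bag t)).toFinset
      exists_bag_of_adj := fun v w hvw => by simpa using he v trivial w trivial hvw
      connected_of_vertex := fun v => by
        have : {t | v ∈ (Set.toFinite (bag t)).toFinset} = {t | v ∈ bag t} := by ext; simp
        rw [this]
        exact hv v trivial }
  have hD : D.width ≤ (K : ℤ) - 1 := by
    unfold TreeDecomposition.width
    have : (Finset.univ.sup fun t => (D.bag t).card) ≤ K := Finset.sup_le fun t _ => by
      rw [← Set.ncard_eq_toFinset_card]
      exact hc t
    have : ((Finset.univ.sup fun t => (D.bag t).card : ℕ) : ℤ) ≤ K := by exact_mod_cast this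
    linarith
  refine (csInf_le ⟨-1, ?_⟩ (Set.mem_range_self D)).trans hD
  rintro _ ⟨D', rfl⟩
  exact D'.neg_one_le_width

/-! ### Small boundaries, buildings and separations -/

/-- The edges between `A` and its complement can be covered by at most `k` vertices. -/
def HasSmallBoundary {V : Type*} (G : SimpleGraph V) (k : ℕ) (A : Set V) : Prop :=
  ∃ S : Set V, S.ncard ≤ k ∧ ∀ v w, G.Adj v w → v ∈ A → w ∉ A → v ∈ S ∨ w ∈ S

theorem HasSmallBoundary.compl {V : Type*} {G : SimpleGraph V} {k : ℕ} {A : Set V}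
    (h : HasSmallBoundary G k A) : HasSmallBoundary G k Aᶜ := by
  obtain ⟨S, hS, h⟩ := h
  exact ⟨S, hS, fun v w hvw hv hw => (h w v hvw.symm (not_not.1 hw) hv).symm⟩

/-- The sets that can be built from the sets in `𝒮` by disjoint unions with small boundary. -/
inductive Buildable {V : Type*} (G : SimpleGraph V) (k : ℕ) (𝒮 : Set (Set V)) : Set V → Prop
  | base {A : Set V} : A ∈ 𝒮 → Buildable G k 𝒮 A
  | union {A B : Set V} : Buildable G k 𝒮 A → Buildable G k 𝒮 B → Disjoint A B →
      HasSmallBoundary G k (A ∪ B) → Buildable G k 𝒮 (A ∪ B)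

/-- A separation of `G` with `A` on the left and the complement of `A` on the right. -/
def IsSeparation {V : Type*} (G : SimpleGraph V) (A : Set V) (p : Set V × Set V) : Prop :=
  A ⊆ p.1 ∧ Aᶜ ⊆ p.2 ∧ ∀ v w, G.Adj v w → v ∉ p.2 → w ∈ p.1

/-- Minimising this cost means minimising the order of the separation first, and then the size of
its left side. -/
noncomputable def separationCost {V : Type*} (p : Set V × Set V) : ℕ :=
  (Nat.card V + 2) * p.1.ncard + (Nat.card V + 1) * p.2.ncard

/-- A separation of minimum cost. -/
def IsMinSeparation {V : Type*} (G : SimpleGraph V) (A : Set V) (p : Set V × Set V) : Prop :=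
  IsSeparation G A p ∧ ∀ q, IsSeparation G A q → separationCost p ≤ separationCost q

theorem IsSeparation.union_eq_univ {V : Type*} {G : SimpleGraph V} {A : Set V} {p : Set V × Set V} (h : IsSeparation G A p) :
    p.1 ∪ p.2 = Set.univ := by
  ext v
  by_cases hv : v ∈ A
  · simp [h.1 hv]
  · simp [h.2.1 hv]

/-- Buildings that use an extra set can be rerooted at that set. -/
theorem Buildable.of_insert {V : Type*} {G : SimpleGraph V} {k : ℕ} {𝒮 : Set (Set V)} {A₀ B : Set V} (h₀ : A₀.Nonempty)
    (h : Buildable G k (insert A₀ 𝒮) B) (hg : ∀ A ∈ insert A₀ 𝒮, HasSmallBoundary G k A) :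
    HasSmallBoundary G k B ∧ (Buildable G k 𝒮 B ∨
      (A₀ ⊆ B ∧ (Buildable G k 𝒮 Bᶜ → Buildable G k 𝒮 A₀ᶜ))) := by
  induction h with
  | @base A hA =>
    refine ⟨hg A hA, ?_⟩
    rcases hA with rfl | hA
    · exact Or.inr ⟨subset_rfl, id⟩
    · exact Or.inl (.base hA)
  | @union A B hA hB hAB hgood ihA ihB =>
    refine ⟨hgood, ?_⟩
    have compl_left : ∀ {A B : Set V}, Disjoint A B → Aᶜ = (A ∪ B)ᶜ ∪ B := by
      intro A B h
      ext v
      have := fun hv : v ∈ A => Set.disjoint_left.1 h hv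
      simp only [Set.mem_compl_iff, Set.mem_union]
      tauto
    -- Rerooting: the complement of a child is the complement of its parent together with the
    -- sibling, and it has the same boundary as the child. Iterating this walks from the root down
    -- to `A₀`, which disjointness allows to occur only once.
    have step : ∀ {A B : Set V}, Disjoint A B → HasSmallBoundary G k A → Buildable G k 𝒮 B →
        Buildable G k 𝒮 (A ∪ B)ᶜ → Buildable G k 𝒮 Aᶜ := by
      intro A B h hA hB hU
      have := hA.compl
      rw [compl_left h] at this ⊢
      exact .union hU hB (Set.disjoint_left.2 fun v h1 h2 => h1 (Or.inr h2)) this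
    rcases ihA with ⟨gA, hA' | ⟨hA1, hA2⟩⟩ <;> rcases ihB with ⟨gB, hB' | ⟨hB1, hB2⟩⟩
    · exact Or.inl (.union hA' hB' hAB hgood)
    · refine Or.inr ⟨hB1.trans Set.subset_union_right, fun h => hB2 (step hAB.symm gB hA' ?_)⟩
      rwa [Set.union_comm]
    · exact Or.inr ⟨hA1.trans Set.subset_union_left, fun h => hA2 (step hAB gA hB' h)⟩
    · obtain ⟨v, hv⟩ := h₀
      exact absurd (hB1 hv) (Set.disjoint_left.1 hAB (hA1 hv))

/-- The canonical separations used for the nodes of a hierarchical decomposition. -/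
def IsCanonicalSeparation {V : Type*} (G : SimpleGraph V) (A : Set V) (p : Set V × Set V) : Prop :=
  (A.Subsingleton ∧ p = (A, Set.univ)) ∨ (¬ A.Subsingleton ∧ IsMinSeparation G A p)

theorem IsCanonicalSeparation.isSeparation {V : Type*} {G : SimpleGraph V} {A : Set V} {p : Set V × Set V}
    (h : IsCanonicalSeparation G A p) : IsSeparation G A p := by
  rcases h with ⟨-, rfl⟩ | ⟨-, h⟩
  · exact ⟨subset_rfl, Set.subset_univ _, fun v w _ hv => absurd trivial hv⟩
  · exact h.1

/-! ### Uncrossing minimum separations, and the tree decomposition of a building -/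

section
variable {V : Type*} [Finite V] {G : SimpleGraph V} {k : ℕ}

theorem ncard_inter_add_card {X Y : Set V} (h : X ∪ Y = Set.univ) :
    (X ∩ Y).ncard + Nat.card V = X.ncard + Y.ncard := by
  rw [← Set.ncard_union_add_ncard_inter X Y, h, Set.ncard_univ]; omega

theorem ncard_le_card (X : Set V) : X.ncard ≤ Nat.card V := by
  rw [← Set.ncard_univ]; exact Set.ncard_le_ncard (Set.subset_univ X)

theorem exists_isMinSeparation (G : SimpleGraph V) (A : Set V) : ∃ p, IsMinSeparation G A p := by
  have hne : {p : Set V × Set V | IsSeparation G A p}.Nonempty :=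
    ⟨(Set.univ, Set.univ), Set.subset_univ _, Set.subset_univ _, fun _ _ _ _ => trivial⟩
  obtain ⟨p, hp, hmin⟩ := Set.exists_min_image _ separationCost (Set.toFinite _) hne
  exact ⟨p, hp, hmin⟩

/-- If `S` covers the boundary, `(A ∪ S, Aᶜ ∪ S)` is a separation of order `|S|`. The two sides of a
separation have sizes summing to `n` plus its order, and the tie-break on the left side is at most
`n`, so it cannot outweigh a larger order. -/
theorem IsMinSeparation.ncard_inter_le {A : Set V} {p : Set V × Set V} (h : IsMinSeparation G A p)
    (hA : HasSmallBoundary G k A) : (p.1 ∩ p.2).ncard ≤ k := by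
  obtain ⟨S, hS, hcov⟩ := hA
  have hq : IsSeparation G A (A ∪ S, Aᶜ ∪ S) := by
    refine ⟨Set.subset_union_left, Set.subset_union_left, fun v w hvw hv => ?_⟩
    simp only [Set.mem_union, Set.mem_compl_iff, not_or, not_not] at hv ⊢
    by_contra! hw
    rcases hcov v w hvw hv.1 hw.1 with h | h
    · exact hv.2 h
    · exact hw.2 h
  have hle := h.2 _ hq
  have e1 := ncard_inter_add_card h.1.union_eq_univ
  have e2 := ncard_inter_add_card hq.union_eq_univ
  have e3 : ((A ∪ S) ∩ (Aᶜ ∪ S)) = S := by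
    rw [← Set.inter_union_distrib_right]; simp
  simp only at e2
  rw [e3] at e2
  have e4 := ncard_le_card (A ∪ S)
  simp only [separationCost] at hle
  set n := Nat.card V
  by_contra! hk
  have e5 : n + k + 1 ≤ p.1.ncard + p.2.ncard := by omega
  have e6 : (A ∪ S).ncard + (Aᶜ ∪ S).ncard ≤ n + k := by omega
  nlinarith

/-- Uncrossing: compare `p` with `(p.1 ∩ q.1, p.2 ∪ q.2)` and `q` with `(p.1 ∪ q.1, p.2 ∩ q.2)`. If
`x` vertices leave the left of `p` and `y` join its right, the two minimalities give `(n+2)x =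
(n+1)y`; since `x ≤ n`, both vanish. The tie-break in the cost is what forces actual inclusions. -/
theorem IsMinSeparation.mono {A B : Set V} {p q : Set V × Set V} (hp : IsMinSeparation G A p)
    (hq : IsMinSeparation G B q) (hAB : A ⊆ B) : p.1 ⊆ q.1 ∧ q.2 ⊆ p.2 := by
  obtain ⟨⟨a1, a2, a3⟩, ha⟩ := hp
  obtain ⟨⟨b1, b2, b3⟩, hb⟩ := hq
  have h1 : IsSeparation G A (p.1 ∩ q.1, p.2 ∪ q.2) := by
    refine ⟨Set.subset_inter a1 (hAB.trans b1), a2.trans Set.subset_union_left,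
      fun v w hvw hv => ?_⟩
    simp only [Set.mem_union, not_or] at hv
    exact ⟨a3 v w hvw hv.1, b3 v w hvw hv.2⟩
  have h2 : IsSeparation G B (p.1 ∪ q.1, p.2 ∩ q.2) := by
    refine ⟨b1.trans Set.subset_union_right,
      Set.subset_inter ((Set.compl_subset_compl.2 hAB).trans a2) b2, fun v w hvw hv => ?_⟩
    by_cases h : v ∈ p.2
    · exact Or.inr (b3 v w hvw fun h' => hv ⟨h, h'⟩)
    · exact Or.inl (a3 v w hvw h)
  have c1 := ha _ h1
  have c2 := hb _ h2
  simp only [separationCost] at c1 c2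
  have e1 := Set.ncard_union_add_ncard_inter p.1 q.1
  have e2 := Set.ncard_union_add_ncard_inter p.2 q.2
  have d1 : (p.1 ∩ q.1).ncard ≤ p.1.ncard := Set.ncard_le_ncard Set.inter_subset_left
  have d2 : p.2.ncard ≤ (p.2 ∪ q.2).ncard := Set.ncard_le_ncard Set.subset_union_left
  have hn := ncard_le_card p.1
  obtain ⟨x, hx⟩ := Nat.exists_eq_add_of_le d1
  obtain ⟨y, hy⟩ := Nat.exists_eq_add_of_le d2
  set n := Nat.card V
  have ex : (p.1 ∪ q.1).ncard = q.1.ncard + x := by omega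
  have ey : (p.2 ∩ q.2).ncard + y = q.2.ncard := by omega
  have k1 : (n + 2) * x ≤ (n + 1) * y := by rw [hx, hy] at c1; nlinarith
  have k2 : (n + 1) * y ≤ (n + 2) * x := by rw [ex, ← ey] at c2; nlinarith
  have hxn : x ≤ n := by omega
  have hxy : x ≤ y := by
    by_contra! h
    nlinarith
  have hx0 : x = 0 := by
    by_contra hx0
    obtain ⟨z, rfl⟩ := Nat.exists_eq_add_of_le hxy
    rcases Nat.eq_zero_or_pos z with rfl | hz
    · nlinarith [Nat.pos_of_ne_zero hx0]
    · nlinarith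
  have hy0 : y = 0 := by
    subst hx0
    nlinarith
  constructor
  · have := Set.eq_of_subset_of_ncard_le (s := p.1 ∩ q.1) (t := p.1) Set.inter_subset_left (by omega)
    exact Set.inter_eq_left.1 this
  · have := Set.eq_of_subset_of_ncard_le (s := p.2) (t := p.2 ∪ q.2) Set.subset_union_left (by omega)
    exact Set.union_eq_left.1 this.symm

/-- Uncrossing with the sides of one separation exchanged: minimality gives `(n+2)x ≤ (n+1)y` and
`(n+2)y ≤ (n+1)x`, so nothing moves. -/
theorem IsMinSeparation.subset_of_disjoint {A B : Set V} {p q : Set V × Set V}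
    (hp : IsMinSeparation G A p) (hq : IsMinSeparation G B q) (hAB : Disjoint A B) :
    p.1 ⊆ q.2 := by
  obtain ⟨⟨a1, a2, a3⟩, ha⟩ := hp
  obtain ⟨⟨b1, b2, b3⟩, hb⟩ := hq
  have h1 : IsSeparation G A (p.1 ∩ q.2, p.2 ∪ q.1) := by
    refine ⟨Set.subset_inter a1 (hAB.subset_compl_right.trans b2), a2.trans Set.subset_union_left,
      fun v w hvw hv => ?_⟩
    simp only [Set.mem_union, not_or] at hv
    refine ⟨a3 v w hvw hv.1, ?_⟩
    by_contra h
    exact hv.2 (b3 w v hvw.symm h)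
  have h2 : IsSeparation G B (q.1 ∩ p.2, q.2 ∪ p.1) := by
    refine ⟨Set.subset_inter b1 (hAB.subset_compl_left.trans a2), b2.trans Set.subset_union_left,
      fun v w hvw hv => ?_⟩
    simp only [Set.mem_union, not_or] at hv
    refine ⟨b3 v w hvw hv.1, ?_⟩
    by_contra h
    exact hv.2 (a3 w v hvw.symm h)
  have c1 := ha _ h1
  have c2 := hb _ h2
  simp only [separationCost] at c1 c2
  have e1 := Set.ncard_union_add_ncard_inter q.2 p.1
  have e2 := Set.ncard_union_add_ncard_inter p.2 q.1
  rw [Set.inter_comm] at e1 e2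
  have d1 : (p.1 ∩ q.2).ncard ≤ p.1.ncard := Set.ncard_le_ncard Set.inter_subset_left
  have d2 : (q.1 ∩ p.2).ncard ≤ q.1.ncard := Set.ncard_le_ncard Set.inter_subset_left
  obtain ⟨x, hx⟩ := Nat.exists_eq_add_of_le d1
  obtain ⟨y, hy⟩ := Nat.exists_eq_add_of_le d2
  set n := Nat.card V
  have ex : (q.2 ∪ p.1).ncard = q.2.ncard + x := by omega
  have ey : (p.2 ∪ q.1).ncard = p.2.ncard + y := by omega
  rw [ey, hx] at c1
  rw [ex, hy] at c2
  have hx0 : x = 0 := by nlinarith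
  have := Set.eq_of_subset_of_ncard_le (s := p.1 ∩ q.2) (t := p.1) Set.inter_subset_left (by omega)
  exact Set.inter_eq_left.1 this

theorem exists_isCanonicalSeparation (G : SimpleGraph V) (A : Set V) :
    ∃ p, IsCanonicalSeparation G A p := by
  by_cases h : A.Subsingleton
  · exact ⟨_, Or.inl ⟨h, rfl⟩⟩
  · obtain ⟨p, hp⟩ := exists_isMinSeparation G A
    exact ⟨p, Or.inr ⟨h, hp⟩⟩

theorem IsCanonicalSeparation.ncard_inter_le {A : Set V} {p : Set V × Set V}
    (h : IsCanonicalSeparation G A p) (hk : 1 ≤ k) (hA : HasSmallBoundary G k A) :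
    (p.1 ∩ p.2).ncard ≤ k := by
  rcases h with ⟨h, rfl⟩ | ⟨-, h⟩
  · simp only [Set.inter_univ]
    exact ((Set.ncard_le_one_iff_subsingleton).2 h).trans hk
  · exact h.ncard_inter_le hA

theorem IsCanonicalSeparation.mono {A B : Set V} {p q : Set V × Set V}
    (hp : IsCanonicalSeparation G A p) (hq : IsCanonicalSeparation G B q) (hAB : A ⊆ B)
    (hB : ¬ B.Subsingleton) : p.1 ⊆ q.1 ∧ q.2 ⊆ p.2 := by
  replace hq := hq.resolve_left fun h => hB h.1
  rcases hp with ⟨h, rfl⟩ | ⟨-, h⟩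
  · exact ⟨hAB.trans hq.2.1.1, Set.subset_univ _⟩
  · exact h.mono hq.2 hAB

theorem IsCanonicalSeparation.subset_of_disjoint {A B : Set V} {p q : Set V × Set V}
    (hp : IsCanonicalSeparation G A p) (hq : IsCanonicalSeparation G B q) (hAB : Disjoint A B) :
    p.1 ⊆ q.2 := by
  rcases hp with ⟨h, rfl⟩ | ⟨-, h⟩
  · exact hAB.subset_compl_right.trans hq.isSeparation.2.1
  · rcases hq with ⟨h', rfl⟩ | ⟨-, h'⟩
    · exact Set.subset_univ _
    · exact h.subset_of_disjoint h' hAB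

theorem ncard_union_three_le {A B C D : Set V} (h : D ⊆ A ∪ B ∪ C) (hA : A.ncard ≤ k)
    (hB : B.ncard ≤ k) (hC : C.ncard ≤ k) : D.ncard ≤ 3 * k := by
  have h1 := Set.ncard_le_ncard h
  have h2 := Set.ncard_union_le (A ∪ B) C
  have h3 := Set.ncard_union_le A B
  omega

theorem HasSmallBoundary.of_subsingleton (hk : 1 ≤ k) {A : Set V} (h : A.Subsingleton) :
    HasSmallBoundary G k A :=
  ⟨A, ((Set.ncard_le_one_iff_subsingleton).2 h).trans hk, fun _ _ _ hv _ => Or.inl hv⟩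

/-- A node `A ∪ B` with separations `p`, `a`, `b` gets the bag `p.1 ∩ a.2 ∩ b.2`. Each of its
vertices lies in `A`, in `B` or outside both, hence in one of three separators of order at most `k`.
The nesting of the separations puts the vertices shared with the children in the root bags, as
gluing requires. -/
theorem Buildable.hasTreeDecomp (hk : 1 ≤ k) {A : Set V}
    (h : Buildable G k {A | A.Subsingleton} A) :
    HasSmallBoundary G k A ∧ ∀ p, IsCanonicalSeparation G A p →
      HasTreeDecomp G p.1 (p.1 ∩ p.2) (3 * k) := by
  have small : ∀ {A : Set V}, A.Subsingleton → HasSmallBoundary G k A ∧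
      ∀ p, IsCanonicalSeparation G A p → HasTreeDecomp G p.1 (p.1 ∩ p.2) (3 * k) := by
    intro A hA
    refine ⟨.of_subsingleton hk hA, fun p hp => ?_⟩
    have : p = (A, Set.univ) := by
      rcases hp with h | h
      · exact h.2
      · exact absurd hA h.1
    subst this
    have h1 : A.ncard ≤ 1 := (Set.ncard_le_one_iff_subsingleton).2 hA
    simpa using HasTreeDecomp.single G (show A.ncard ≤ 3 * k by omega)
  induction h with
  | base h => exact small h
  | @union A B hA hB hAB hgood ihA ihB =>
    by_cases hs : (A ∪ B).Subsingleton
    · exact small hs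
    refine ⟨hgood, fun p hp => ?_⟩
    obtain ⟨a, ha⟩ := exists_isCanonicalSeparation G A
    obtain ⟨b, hb⟩ := exists_isCanonicalSeparation G B
    have hap := ha.mono hp Set.subset_union_left hs
    have hbp := hb.mono hp Set.subset_union_right hs
    have hab := ha.subset_of_disjoint hb hAB
    have hba := hb.subset_of_disjoint ha hAB.symm
    have hcard : (p.1 ∩ a.2 ∩ b.2).ncard ≤ 3 * k := by
      refine ncard_union_three_le (A := p.1 ∩ p.2) (B := a.1 ∩ a.2) (C := b.1 ∩ b.2) ?_
        (hp.ncard_inter_le hk hgood) (ha.ncard_inter_le hk ihA.1) (hb.ncard_inter_le hk ihB.1)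
      rintro v ⟨⟨h1, h2⟩, h3⟩
      by_cases hvA : v ∈ A
      · exact Or.inl (Or.inr ⟨ha.isSeparation.1 hvA, h2⟩)
      · by_cases hvB : v ∈ B
        · exact Or.inr ⟨hb.isSeparation.1 hvB, h3⟩
        · exact Or.inl (Or.inl ⟨h1, hp.isSeparation.2.1 fun h => h.elim hvA hvB⟩)
    have hroot : a.1 ∩ b.1 ⊆ p.1 ∩ a.2 ∩ b.2 := fun v hv =>
      ⟨⟨hap.1 hv.1, hba hv.2⟩, hab hv.1⟩
    have g1 := (HasTreeDecomp.single G hcard).glue (ihA.2 a ha) Set.inter_subset_left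
      (fun v hv => ⟨hv.2, hv.1.1.2⟩) (by
        rintro v hv w hw hvw
        by_contra! hcon
        rcases hv with hv | hv
        · rcases hw with hw | hw
          · exact hcon.1 hv hw
          · by_cases h : w ∈ a.2
            · exact hcon.1 hv ⟨⟨hap.1 hw, h⟩, hab hw⟩
            · exact hcon.2 (ha.isSeparation.2.2 w v hvw.symm h) hw
        · rcases hw with hw | hw
          · by_cases h : v ∈ a.2
            · exact hcon.1 ⟨⟨hap.1 hv, h⟩, hab hv⟩ hw
            · exact hcon.2 hv (ha.isSeparation.2.2 v w hvw h)
          · exact hcon.2 hv hw)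
    have hX : p.1 = (p.1 ∩ a.2 ∩ b.2) ∪ a.1 ∪ b.1 := by
      apply Set.Subset.antisymm
      · intro v hv
        by_cases h1 : v ∈ a.1
        · exact Or.inl (Or.inr h1)
        by_cases h2 : v ∈ b.1
        · exact Or.inr h2
        have h3 := (ha.isSeparation.union_eq_univ.ge (Set.mem_univ v)).resolve_left h1
        have h4 := (hb.isSeparation.union_eq_univ.ge (Set.mem_univ v)).resolve_left h2
        exact Or.inl (Or.inl ⟨⟨hv, h3⟩, h4⟩)
      · rintro v ((hv | hv) | hv)
        · exact hv.1.1
        · exact hap.1 hv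
        · exact hbp.1 hv
    have key : ∀ v ∈ p.1, v ∈ b.2 → v ∈ (p.1 ∩ a.2 ∩ b.2) ∪ a.1 := fun v h1 h2 => by
      by_cases h3 : v ∈ a.1
      · exact Or.inr h3
      · exact Or.inl ⟨⟨h1, (ha.isSeparation.union_eq_univ.ge (Set.mem_univ v)).resolve_left h3⟩, h2⟩
    have g2 := g1.glue (ihB.2 b hb) (by
        rintro v ⟨h1 | h1, h2⟩
        · exact h1
        · exact hroot ⟨h1, h2⟩) (by
        rintro v ⟨h1 | h1, h2⟩
        · exact ⟨h2, h1.2⟩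
        · exact ⟨h2, hab h1⟩) (by
        rw [← hX]
        intro v hv w hw hvw
        by_cases h1 : v ∈ b.2
        · by_cases h2 : w ∈ b.2
          · exact Or.inl ⟨key v hv h1, key w hw h2⟩
          · have h3 : w ∈ b.1 :=
              (hb.isSeparation.union_eq_univ.ge (Set.mem_univ w)).resolve_right h2
            exact Or.inr ⟨hb.isSeparation.2.2 w v hvw.symm h2, h3⟩
        · have h3 : v ∈ b.1 :=
            (hb.isSeparation.union_eq_univ.ge (Set.mem_univ v)).resolve_right h1
          exact Or.inr ⟨h3, hb.isSeparation.2.2 v w hvw h1⟩)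
    rw [← hX] at g2
    exact g2.mono fun v hv => ⟨⟨hv.1, hap.2 hv.2⟩, hbp.2 hv.2⟩

theorem Buildable.treewidth_le (hk : 1 ≤ k) (h : Buildable G k {A | A.Subsingleton} Set.univ) :
    treewidth G ≤ 3 * (k : ℤ) - 1 := by
  obtain ⟨p, hp⟩ := exists_isCanonicalSeparation G Set.univ
  have h1 := (h.hasTreeDecomp hk).2 p hp
  have h2 : p.1 = Set.univ := Set.univ_subset_iff.1 hp.isSeparation.1
  rw [h2] at h1
  simpa using treewidth_le_of_hasTreeDecomp h1

/-! ### Small sets when `V` is not buildable -/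

/-- If the vertex set is not buildable, then there is a consistent notion of small sets. -/
theorem exists_small_sets (hk : 1 ≤ k) (h : ¬ Buildable G k {A | A.Subsingleton} Set.univ) :
    ∃ small : Set V → Prop, (∀ A, A.Subsingleton → small A) ∧
      (∀ A B, small A → small B → Disjoint A B → HasSmallBoundary G k (A ∪ B) → small (A ∪ B)) ∧
      (∀ A, HasSmallBoundary G k A → small A ∨ small Aᶜ) ∧ ¬ small Set.univ := by
  let P : Set (Set V) → Prop := fun 𝒮 => {A | A.Subsingleton} ⊆ 𝒮 ∧
    (∀ A ∈ 𝒮, HasSmallBoundary G k A) ∧ ¬ Buildable G k 𝒮 Set.univ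
  have hP : P {A | A.Subsingleton} := ⟨subset_rfl, fun A hA => .of_subsingleton hk hA, h⟩
  -- A maximal family of admissible starting sets from which `V` cannot be built; "small" will mean
  -- buildable from it.
  obtain ⟨𝒮, hmax⟩ := (Set.toFinite {𝒮 | P 𝒮}).exists_maximal ⟨_, hP⟩
  obtain ⟨h1, h2, h3⟩ := hmax.1
  refine ⟨Buildable G k 𝒮, fun A hA => .base (h1 hA), fun A B => .union, fun A hA => ?_, h3⟩
  by_cases hmem : A ∈ 𝒮
  · exact Or.inl (.base hmem)
  have hne : A.Nonempty := by
    rw [Set.nonempty_iff_ne_empty]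
    rintro rfl
    exact hmem (h1 Set.subsingleton_empty)
  have hins : ∀ B ∈ insert A 𝒮, HasSmallBoundary G k B := by
    rintro B (rfl | hB)
    · exact hA
    · exact h2 B hB
  have hb : Buildable G k (insert A 𝒮) Set.univ := by
    by_contra hb
    have hle := hmax.2 (y := insert A 𝒮) ⟨h1.trans (Set.subset_insert _ _), hins, hb⟩
      (Set.subset_insert _ _)
    exact hmem (hle (Set.mem_insert _ _))
  -- By maximality `A` makes `V` buildable. Rerooting that building at `A` produces `Aᶜ`, starting
  -- from the complement of `V`, which is empty.
  rcases (hb.of_insert hne hins).2 with h | ⟨-, h⟩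
  · exact absurd h h3
  · refine Or.inr (h (.base (h1 ?_)))
    simp
end

/-! ### Orientation of triangles, and chords of a disc -/

/-- Twice the signed area of the triangle `p q x`. -/
def orient (p q x : Plane) : ℝ := (q 0 - p 0) * (x 1 - p 1) - (q 1 - p 1) * (x 0 - p 0)

theorem orient_swap (p q x : Plane) : orient q p x = -orient p q x := by
  simp only [orient]; ring

theorem orient_rotate (p q x : Plane) : orient p q x = orient x p q := by
  simp only [orient]; ring

theorem orient_left (p q : Plane) : orient p q p = 0 := by
  simp only [orient]; ring

theorem orient_right (p q : Plane) : orient p q q = 0 := by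
  simp only [orient]; ring

theorem orient_combo (p q a b : Plane) {s t : ℝ} (h : s + t = 1) :
    orient p q (s • a + t • b) = s * orient p q a + t * orient p q b := by
  obtain rfl : s = 1 - t := by linarith
  simp only [orient, PiLp.add_apply, PiLp.smul_apply, smul_eq_mul]
  ring

theorem convex_orient_nonneg (p q : Plane) : Convex ℝ {x | 0 ≤ orient p q x} := by
  intro a ha b hb s t hs ht hst
  simp only [Set.mem_ofPred_eq] at *
  rw [orient_combo p q a b hst]
  positivity

theorem convex_orient_nonpos (p q : Plane) : Convex ℝ {x | orient p q x ≤ 0} := by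
  intro a ha b hb s t hs ht hst
  simp only [Set.mem_ofPred_eq] at *
  rw [orient_combo p q a b hst]
  nlinarith [mul_nonneg hs (neg_nonneg.2 ha), mul_nonneg ht (neg_nonneg.2 hb)]

theorem orient_eq_zero_of_mem_segment {p q x : Plane} (h : x ∈ segment ℝ p q) :
    orient p q x = 0 := by
  obtain ⟨s, t, -, -, hst, rfl⟩ := h
  rw [orient_combo p q p q hst, orient_left, orient_right]
  ring

theorem exists_orient_eq_zero {p q a b : Plane} (h : orient p q a * orient p q b < 0) :
    ∃ x ∈ openSegment ℝ a b, orient p q x = 0 := by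
  set α := orient p q a with hα
  set β := orient p q b with hβ
  have hne : β - α ≠ 0 := by
    intro h0
    obtain h1 : β = α := by linarith
    rw [h1] at h
    exact absurd h (mul_self_nonneg α).not_gt
  have hst : β / (β - α) + (-α) / (β - α) = 1 := by field_simp; ring
  have h2 : 0 < (β - α) * (β - α) := mul_self_pos.2 hne
  refine ⟨(β / (β - α)) • a + ((-α) / (β - α)) • b, ⟨_, _, ?_, ?_, hst, rfl⟩, ?_⟩
  · rw [show β / (β - α) = (β * (β - α)) / ((β - α) * (β - α)) by field_simp]
    apply div_pos _ h2
    nlinarith [mul_self_nonneg β]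
  · rw [show (-α) / (β - α) = ((-α) * (β - α)) / ((β - α) * (β - α)) by field_simp]
    apply div_pos _ h2
    nlinarith [mul_self_nonneg α]
  · rw [orient_combo p q a b hst, ← hα, ← hβ]
    field_simp
    ring

/-- If the two ends of a segment lie weakly on the same side of a line, and the line meets the
interior of the segment, then both ends lie on the line. -/
theorem orient_eq_zero_of_mem_openSegment {p q a b x : Plane} (hx : x ∈ openSegment ℝ a b)
    (h0 : orient p q x = 0) (h : 0 ≤ orient p q a * orient p q b) :
    orient p q a = 0 ∧ orient p q b = 0 := by
  obtain ⟨s, t, hs, ht, hst, rfl⟩ := hx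
  rw [orient_combo p q a b hst] at h0
  have h1 : s * (orient p q a * orient p q a) + t * (orient p q a * orient p q b) = 0 := by
    linear_combination orient p q a * h0
  have h2 : orient p q a * orient p q a = 0 := by
    have := mul_self_nonneg (orient p q a)
    nlinarith [mul_nonneg ht.le h, mul_nonneg hs.le this]
  have h3 : orient p q a = 0 := mul_self_eq_zero.1 h2
  refine ⟨h3, ?_⟩
  rw [h3] at h0
  have : t * orient p q b = 0 := by linarith
  exact (mul_eq_zero.1 this).resolve_left ht.ne'

theorem plane_ext {x y : Plane} (h0 : x 0 = y 0) (h1 : x 1 = y 1) : x = y := by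
  ext i; fin_cases i
  · exact h0
  · exact h1

theorem dist_sq_plane (x y : Plane) : dist x y ^ 2 = (x 0 - y 0) ^ 2 + (x 1 - y 1) ^ 2 := by
  rw [EuclideanSpace.dist_eq, Real.sq_sqrt (by positivity), Fin.sum_univ_two, Real.dist_eq,
    Real.dist_eq, sq_abs, sq_abs]

/-- A point of a disc on the line through two points of the bounding circle lies between them. -/
theorem mem_segment_of_orient_eq_zero {o p q x : Plane} {r : ℝ} (hp : p ∈ Metric.sphere o r)
    (hq : q ∈ Metric.sphere o r) (hpq : p ≠ q) (hx : x ∈ Metric.closedBall o r)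
    (h : orient p q x = 0) : x ∈ segment ℝ p q := by
  rw [Metric.mem_sphere] at hp hq
  rw [Metric.mem_closedBall] at hx
  have ep : (p 0 - o 0) ^ 2 + (p 1 - o 1) ^ 2 = r ^ 2 := by rw [← dist_sq_plane, hp]
  have eq : (q 0 - o 0) ^ 2 + (q 1 - o 1) ^ 2 = r ^ 2 := by rw [← dist_sq_plane, hq]
  have ex : (x 0 - o 0) ^ 2 + (x 1 - o 1) ^ 2 ≤ r ^ 2 := by
    rw [← dist_sq_plane]; exact pow_le_pow_left₀ dist_nonneg hx 2
  set u := q 0 - p 0 with hu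
  set w := q 1 - p 1 with hw
  have hD : 0 < u ^ 2 + w ^ 2 := by
    rcases (add_nonneg (sq_nonneg u) (sq_nonneg w)).lt_or_eq with h' | h'
    · exact h'
    · exfalso
      have h1 : u = 0 := by nlinarith [sq_nonneg u, sq_nonneg w]
      have h2 : w = 0 := by nlinarith [sq_nonneg u, sq_nonneg w]
      exact hpq (plane_ext (by linarith) (by linarith))
  simp only [orient, ← hu, ← hw] at h
  -- The coordinate of `x` on the line `p + t (q - p)`. Below, `(t² - t)|q - p|² = |x - o|² - r²`,
  -- so lying in the disc means `0 ≤ t ≤ 1`.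
  set t := (u * (x 0 - p 0) + w * (x 1 - p 1)) / (u ^ 2 + w ^ 2) with ht
  have h0 : x 0 - p 0 = t * u := by
    rw [ht, div_mul_eq_mul_div, eq_div_iff hD.ne']
    linear_combination (-w) * h
  have h1 : x 1 - p 1 = t * w := by
    rw [ht, div_mul_eq_mul_div, eq_div_iff hD.ne']
    linear_combination u * h
  have hkey : (t ^ 2 - t) * (u ^ 2 + w ^ 2) ≤ 0 := by
    have e1 : 2 * ((p 0 - o 0) * u + (p 1 - o 1) * w) + (u ^ 2 + w ^ 2) = 0 := by
      rw [hu, hw]; linear_combination eq - ep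
    have e2 : x 0 - o 0 = (p 0 - o 0) + t * u := by linarith
    have e3 : x 1 - o 1 = (p 1 - o 1) + t * w := by linarith
    rw [e2, e3] at ex
    have e4 : (t ^ 2 - t) * (u ^ 2 + w ^ 2) = ((p 0 - o 0 + t * u) ^ 2 + (p 1 - o 1 + t * w) ^ 2)
        - ((p 0 - o 0) ^ 2 + (p 1 - o 1) ^ 2) := by linear_combination (-t) * e1
    rw [e4, ep]
    linarith
  have htt : t ^ 2 - t ≤ 0 := by
    by_contra! hc
    nlinarith [mul_pos hc hD]
  have ht0 : 0 ≤ t := by nlinarith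
  have ht1 : t ≤ 1 := by nlinarith
  refine ⟨1 - t, t, by linarith, ht0, by ring, ?_⟩
  apply plane_ext
  · simp only [PiLp.add_apply, PiLp.smul_apply, smul_eq_mul]
    linear_combination -h0
  · simp only [PiLp.add_apply, PiLp.smul_apply, smul_eq_mul]
    linear_combination -h1

/-! ### The cyclic order of the vertices and its arcs -/

/-- The points of the family `pos` are in convex position, in counterclockwise order. -/
def IsCounterclockwise {V : Type*} [LinearOrder V] (pos : V → Plane) : Prop :=
  ∀ a b c : V, a < b → b < c → 0 < orient (pos a) (pos b) (pos c)

/-- In terms of angles the signed area is a product of sines of half differences, and these half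
differences lie strictly between `0` and `π`. -/
theorem orient_circle_pos {o p q x : Plane} {r α β γ : ℝ} (hr : 0 < r)
    (hp0 : p 0 = o 0 + r * Real.cos α) (hp1 : p 1 = o 1 + r * Real.sin α)
    (hq0 : q 0 = o 0 + r * Real.cos β) (hq1 : q 1 = o 1 + r * Real.sin β)
    (hx0 : x 0 = o 0 + r * Real.cos γ) (hx1 : x 1 = o 1 + r * Real.sin γ)
    (hα : -Real.pi < α) (hαβ : α < β) (hβγ : β < γ) (hγ : γ ≤ Real.pi) :
    0 < orient p q x := by
  have key : orient p q x = 4 * r ^ 2 * Real.sin ((β - α) / 2) * Real.sin ((γ - α) / 2) *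
      Real.sin ((γ - β) / 2) := by
    have e1 := Real.cos_sub_cos β α
    have e2 := Real.cos_sub_cos γ α
    have e3 := Real.sin_sub_sin β α
    have e4 := Real.sin_sub_sin γ α
    have e5 : Real.sin ((γ - β) / 2) = Real.sin ((γ + α) / 2) * Real.cos ((β + α) / 2)
        - Real.cos ((γ + α) / 2) * Real.sin ((β + α) / 2) := by
      rw [← Real.sin_sub]; congr 1; ring
    have : orient p q x = r ^ 2 * ((Real.cos β - Real.cos α) * (Real.sin γ - Real.sin α)
        - (Real.sin β - Real.sin α) * (Real.cos γ - Real.cos α)) := by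
      simp only [orient, hp0, hp1, hq0, hq1, hx0, hx1]; ring
    rw [this, e1, e2, e3, e4, e5]
    ring
  have s1 : 0 < Real.sin ((β - α) / 2) := Real.sin_pos_of_pos_of_lt_pi (by linarith) (by linarith)
  have s2 : 0 < Real.sin ((γ - α) / 2) := Real.sin_pos_of_pos_of_lt_pi (by linarith) (by linarith)
  have s3 : 0 < Real.sin ((γ - β) / 2) := Real.sin_pos_of_pos_of_lt_pi (by linarith) (by linarith)
  rw [key]
  positivity

/-- The vertices are ordered by their argument as seen from the centre, which determines a point of
the circle. -/
theorem exists_linearOrder_isCounterclockwise {V : Type*} {pos : V → Plane}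
    (hinj : Function.Injective pos) {o : Plane} {r : ℝ} (hr : 0 < r)
    (h : ∀ v, pos v ∈ Metric.sphere o r) : ∃ _ : LinearOrder V, IsCounterclockwise pos := by
  let z : V → ℂ := fun v => ⟨pos v 0 - o 0, pos v 1 - o 1⟩
  have hz : ∀ v, ‖z v‖ = r := by
    intro v
    have h1 : dist (pos v) o ^ 2 = r ^ 2 := by rw [Metric.mem_sphere.1 (h v)]
    rw [dist_sq_plane] at h1
    rw [Complex.norm_def, Complex.normSq_apply, ← Real.sqrt_sq hr.le]
    congr 1
    simp only [z]
    linarith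
  have h0 : ∀ v, pos v 0 = o 0 + r * Real.cos (z v).arg := by
    intro v
    rw [← hz v, Complex.norm_mul_cos_arg]
    simp [z]
  have h1 : ∀ v, pos v 1 = o 1 + r * Real.sin (z v).arg := by
    intro v
    rw [← hz v, Complex.norm_mul_sin_arg]
    simp [z]
  have hθ : Function.Injective fun v => (z v).arg := by
    intro v w hvw
    simp only at hvw
    apply hinj
    apply plane_ext
    · rw [h0, h0, hvw]
    · rw [h1, h1, hvw]
  refine ⟨LinearOrder.lift' _ hθ, ?_⟩
  intro a b c hab hbc
  exact orient_circle_pos hr (h0 a) (h1 a) (h0 b) (h1 b) (h0 c) (h1 c) (Complex.neg_pi_lt_arg _)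
    hab hbc (Complex.arg_le_pi _)

section
variable {V : Type*} [LinearOrder V] {pos : V → Plane}

theorem IsCounterclockwise.orient_pos_of_lt (h : IsCounterclockwise pos) {v w a : V} (hvw : v < w)
    (ha : a < v) : 0 < orient (pos v) (pos w) (pos a) := by
  rw [orient_rotate]; exact h a v w ha hvw

theorem IsCounterclockwise.orient_neg (h : IsCounterclockwise pos) {v w a : V} (hva : v < a)
    (haw : a < w) : orient (pos v) (pos w) (pos a) < 0 := by
  have := h v a w hva haw
  rw [orient_rotate, orient_swap] at this
  linarith

/-- A chord `v w` separates `a` from `b` when `a` separates `v` from `w` in the cyclic order. -/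
theorem IsCounterclockwise.orient_mul_neg_of_lt (h : IsCounterclockwise pos) {v w a b : V}
    (hav : a < v) (hvb : v < b) (hw : w < a ∨ b < w) :
    orient (pos v) (pos w) (pos a) * orient (pos v) (pos w) (pos b) < 0 := by
  rcases hw with hw | hw
  · rw [orient_swap (pos w) (pos v), orient_swap (pos w) (pos v)]
    have h1 := h.orient_neg hw hav
    have h2 := h w v b (hw.trans hav) hvb
    nlinarith
  · have h1 := h.orient_pos_of_lt (hvb.trans hw) hav
    have h2 := h.orient_neg hvb hw
    nlinarith

theorem IsCounterclockwise.orient_ne_zero (h : IsCounterclockwise pos) {v w a : V} (hvw : v ≠ w)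
    (hav : a ≠ v) (haw : a ≠ w) : orient (pos v) (pos w) (pos a) ≠ 0 := by
  wlog hlt : v < w generalizing v w
  · have := this hvw.symm haw hav (lt_of_le_of_ne (not_lt.1 hlt) hvw.symm)
    rw [orient_swap]
    simpa using this
  rcases lt_or_gt_of_ne hav with h1 | h1
  · exact (h.orient_pos_of_lt hlt h1).ne'
  · rcases lt_or_gt_of_ne haw with h2 | h2
    · exact (h.orient_neg h1 h2).ne
    · exact (h v w a hlt h2).ne'

/-- Two points that are consecutive in the cyclic order are on the same side of every chord. -/
theorem IsCounterclockwise.orient_mul_nonneg (h : IsCounterclockwise pos) {v w a b : V}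
    (hab : (∀ x, x ≤ a ∨ b ≤ x) ∧ a ≤ b ∨ (∀ x, a ≤ x ∧ x ≤ b)) :
    0 ≤ orient (pos v) (pos w) (pos a) * orient (pos v) (pos w) (pos b) := by
  wlog hvw : v < w generalizing v w
  · rcases (not_lt.1 hvw).lt_or_eq with h1 | rfl
    · have := this h1
      rw [orient_swap (pos w) (pos v), orient_swap (pos w) (pos v)]
      linarith
    · simp [orient]
  by_cases e1 : a = v
  · subst e1; simp [orient_left]
  by_cases e2 : a = w
  · subst e2; simp [orient_right]
  by_cases e3 : b = v
  · subst e3; simp [orient_left]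
  by_cases e4 : b = w
  · subst e4; simp [orient_right]
  rcases hab with ⟨hab, hle⟩ | hab
  · rcases lt_or_gt_of_ne e1 with h1 | h1
    · have h2 : b < v := lt_of_le_of_ne ((hab v).resolve_left h1.not_ge) e3
      exact (mul_pos (h.orient_pos_of_lt hvw h1) (h.orient_pos_of_lt hvw h2)).le
    · rcases lt_or_gt_of_ne e2 with h2 | h2
      · have h3 : b < w := lt_of_le_of_ne ((hab w).resolve_left h2.not_ge) e4
        exact (mul_pos_of_neg_of_neg (h.orient_neg h1 h2)
          (h.orient_neg (h1.trans_le hle) h3)).le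
      · exact (mul_pos (h v w a hvw h2) (h v w b hvw (h2.trans_le hle))).le
  · have h1 : a < v := lt_of_le_of_ne (hab v).1 e1
    have h2 : w < b := lt_of_le_of_ne (hab w).2 (Ne.symm e4)
    exact (mul_pos (h.orient_pos_of_lt hvw h1) (h v w b hvw h2)).le

/-- `A` consists of the elements from `p` (inclusive) to `q` (exclusive) in the cyclic order. For
`p = q` this can be the empty set or everything. -/
def IsArc (p q : V) (A : Set V) : Prop :=
  (p ≤ q ∧ A = Set.Ico p q) ∨ (q ≤ p ∧ A = (Set.Ico q p)ᶜ)

theorem isArc_empty (p : V) : IsArc p p ∅ := Or.inl ⟨le_rfl, by simp⟩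

theorem IsArc.compl {p q : V} {A : Set V} (h : IsArc p q A) : IsArc q p Aᶜ := by
  rcases h with ⟨h, rfl⟩ | ⟨h, rfl⟩
  · exact Or.inr ⟨h, rfl⟩
  · exact Or.inl ⟨h, compl_compl _⟩

theorem IsArc.union {p q s : V} {A B : Set V} (hA : IsArc p q A) (hB : IsArc q s B)
    (h : Disjoint A B) : IsArc p s (A ∪ B) := by
  have hd : ∀ x, x ∈ A → x ∉ B := fun x hx => Set.disjoint_left.1 h hx
  rcases hA with ⟨h1, rfl⟩ | ⟨h1, rfl⟩ <;> rcases hB with ⟨h2, rfl⟩ | ⟨h2, rfl⟩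
  · exact Or.inl ⟨h1.trans h2, Set.Ico_union_Ico_eq_Ico h1 h2⟩
  · have h3 : s ≤ p := by
      by_contra! h3
      exact hd p ⟨le_rfl, h3.trans_le h2⟩ fun h4 => h3.not_ge h4.1
    refine Or.inr ⟨h3, ?_⟩
    ext x
    simp only [Set.mem_union, Set.mem_Ico, Set.mem_compl_iff]
    grind
  · have h3 : s ≤ p := by
      by_contra! h3
      exact hd p (fun h4 => h4.2.false) ⟨h1, h3⟩
    refine Or.inr ⟨h3, ?_⟩
    ext x
    simp only [Set.mem_union, Set.mem_Ico, Set.mem_compl_iff]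
    grind
  -- Two wrapping arcs would both contain `p`.
  · exact absurd (fun h4 => (h1.trans_lt h4.2).false) (hd p fun h4 => h4.2.false)

/-- If an arc from `a` to `b` separates `v` from `w`, then the chord `v w` separates `a` from `b`. -/
theorem IsCounterclockwise.orient_mul_neg_of_isArc (h : IsCounterclockwise pos) {v w a b : V}
    {A : Set V} (hA : IsArc a b A) (hv : v ∈ A) (hw : w ∉ A) (hva : v ≠ a) (hwb : w ≠ b) :
    orient (pos v) (pos w) (pos a) * orient (pos v) (pos w) (pos b) < 0 := by
  rcases hA with ⟨h1, rfl⟩ | ⟨h1, rfl⟩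
  · refine h.orient_mul_neg_of_lt (lt_of_le_of_ne hv.1 hva.symm) hv.2 ?_
    by_contra! hc
    exact hw ⟨hc.1, lt_of_le_of_ne hc.2 hwb⟩
  · have hw' := not_not.1 hw
    have := h.orient_mul_neg_of_lt (v := w) (w := v) (lt_of_le_of_ne hw'.1 hwb.symm) hw'.2 (by
      by_contra! hc
      exact hv ⟨hc.1, lt_of_le_of_ne hc.2 hva⟩)
    rw [orient_swap (pos w) (pos v), orient_swap (pos w) (pos v)]
    linarith
end

/-- A nonzero sign of `orient` propagates along products. -/
theorem mul_neg_of_mul_pos {x y a b : ℝ} (hx : 0 < x * a) (hy : 0 < y * b) (h : a * b < 0) :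
    x * y < 0 := by
  have h1 : 0 < (x * a) * (y * b) := mul_pos hx hy
  by_contra! h2
  nlinarith [mul_nonneg h2 (neg_nonneg.2 h.le)]

/-! ### Edge interiors and vertex covers -/

namespace GeometricGraph

variable {V : Type*} (G : GeometricGraph V)

theorem openSeg_subset_closedSeg (e : Sym2 Plane) : openSeg e ⊆ closedSeg e := by
  induction e with
  | _ x y => exact openSegment_subset_segment ℝ x y

theorem notMem_openSegment_left {x y : Plane} (h : x ≠ y) : x ∉ openSegment ℝ x y :=
  fun hx => h (left_mem_openSegment_iff.1 hx)

theorem pos_notMem_edgeInterior (e : G.graph.edgeSet) (v : V) : G.pos v ∉ G.edgeInterior e := by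
  intro hv
  have hmem := G.mem_of_pos_mem e e.2 v (openSeg_subset_closedSeg _ hv)
  obtain ⟨⟨a, b⟩, h⟩ := e
  have hab : G.pos a ≠ G.pos b := fun hab => h.ne (G.pos_injective hab)
  have hv' : G.pos v ∈ openSegment ℝ (G.pos a) (G.pos b) := hv
  rcases Sym2.mem_iff.1 hmem with rfl | rfl
  · exact notMem_openSegment_left hab hv'
  · rw [openSegment_symm] at hv'
    exact notMem_openSegment_left hab.symm hv'

/-- A point of the disc on the line of an edge lies in the interior of the edge, unless it is an end
of the edge. -/
theorem mem_edgeInterior_of_orient_eq_zero {o : Plane} {r : ℝ}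
    (hs : ∀ v, G.pos v ∈ Metric.sphere o r) {v w : V} (h : G.graph.Adj v w) {x : Plane}
    (hx : x ∈ Metric.closedBall o r) (h0 : orient (G.pos v) (G.pos w) x = 0)
    (hv : x ≠ G.pos v) (hw : x ≠ G.pos w) : x ∈ G.edgeInterior ⟨s(v, w), h⟩ :=
  mem_openSegment_of_ne_left_right hv.symm hw.symm
    (mem_segment_of_orient_eq_zero (hs v) (hs w) (fun e => h.ne (G.pos_injective e)) hx h0)

theorem crosses_comm {e f : G.graph.edgeSet} (h : G.Crosses e f) : G.Crosses f e := by
  obtain ⟨x, h1, h2, h3⟩ := h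
  exact ⟨x, h1.symm, h3, h2⟩

end GeometricGraph

/-- A set of edges of matching number at most `m` has a vertex cover of size at most `2 * m`. -/
theorem exists_cover_of_matchingNumber_le {V : Type*} [Finite V] {G : SimpleGraph V}
    {E : Set G.edgeSet} {m : ℕ} (h : matchingNumber E ≤ m) :
    ∃ S : Set V, S.ncard ≤ 2 * m ∧ ∀ e ∈ E, ∃ v ∈ S, v ∈ (e : Sym2 V) := by
  have hfin : Finite G.edgeSet := Subtype.finite
  have hne : {M : Set G.edgeSet | M ⊆ E ∧ IsEdgeMatching M}.Nonempty :=
    ⟨∅, Set.empty_subset _, fun e he => absurd he (Set.notMem_empty e)⟩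
  obtain ⟨M, ⟨hME, hM⟩, hmax⟩ := Set.exists_max_image _ Set.ncard (Set.toFinite _) hne
  have hcard : M.ncard ≤ m := by
    have h1 : M.encard ≤ matchingNumber E :=
      le_iSup₂ (f := fun (M : Set G.edgeSet) (_ : M ⊆ E ∧ IsEdgeMatching M) => M.encard) M ⟨hME, hM⟩
    have h2 := h1.trans h
    rw [← (Set.toFinite M).cast_ncard_eq] at h2
    exact_mod_cast h2
  refine ⟨{v | ∃ e ∈ M, v ∈ (e : Sym2 V)}, ?_, ?_⟩
  · let g : Set.Elem M × Bool → V := fun x => if x.2 then (x.1 : Sym2 V).out.1 else (x.1 : Sym2 V).out.2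
    have hsub : {v | ∃ e ∈ M, v ∈ (e : Sym2 V)} ⊆ Set.range g := by
      rintro v ⟨e, he, hv⟩
      have : (e : Sym2 V) = s((e : Sym2 V).out.1, (e : Sym2 V).out.2) := (Quot.out_eq _).symm
      rw [this, Sym2.mem_iff] at hv
      rcases hv with hv | hv
      · exact ⟨(⟨e, he⟩, true), hv.symm⟩
      · exact ⟨(⟨e, he⟩, false), hv.symm⟩
    have h1 := Set.ncard_le_ncard hsub
    have h2 : (Set.range g).ncard ≤ Nat.card (Set.Elem M × Bool) := by
      rw [← Nat.card_coe_set_eq]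
      exact Finite.card_range_le g
    rw [Nat.card_prod, Nat.card_coe_set_eq] at h2
    simp only [Nat.card_eq_fintype_card, Fintype.card_bool] at h2
    omega
  · intro e he
    by_contra! hc
    have hnot : e ∉ M := fun heM =>
      hc (e : Sym2 V).out.1 ⟨e, heM, Sym2.out_fst_mem _⟩ (Sym2.out_fst_mem _)
    have hdis : ∀ f ∈ M, ∀ v : V, ¬ (v ∈ (e : Sym2 V) ∧ v ∈ (f : Sym2 V)) :=
      fun f hf v hv => hc v ⟨f, hf, hv.2⟩ hv.1
    have := hmax (insert e M) ⟨Set.insert_subset he hME, by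
      rintro a (rfl | ha) b (rfl | hb) hab v hv
      · exact hab rfl
      · exact hdis b hb v hv
      · exact hdis a ha v hv.symm
      · exact hM a ha b hb hab v hv⟩
    rw [Set.ncard_insert_of_notMem hnot] at this
    omega

theorem ncard_triple_le {V : Type*} (a b c : V) : ({a, b, c} : Set V).ncard ≤ 3 := by
  have h1 := Set.ncard_insert_le a ({b, c} : Set V)
  have h2 := Set.ncard_insert_le b ({c} : Set V)
  rw [Set.ncard_singleton] at h2
  omega

/-! ### One colour: noncrossing chords -/

section
variable {V : Type*} [LinearOrder V] [Finite V] {G : SimpleGraph V}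

/-- In a graph without crossing edges, every interval with an interior vertex can be split. -/
theorem exists_split_vertex
    (hnc : ∀ a b c d : V, a < b → b < c → c < d → G.Adj a c → ¬ G.Adj b d) {p q : V}
    (h : (Set.Ioo p q).Nonempty) : ∃ r ∈ Set.Ioo p q, ∀ x y, p ≤ x → x < r → r < y → y ≤ q →
      G.Adj x y → x = p ∧ y = q := by
  by_cases hN : {x ∈ Set.Ioo p q | G.Adj p x}.Nonempty
  · obtain ⟨r, ⟨hr, hpr⟩, hmax⟩ := Set.exists_max_image _ id (Set.toFinite _) hN
    refine ⟨r, hr, fun x y hpx hxr hry hyq hxy => ?_⟩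
    rcases hpx.lt_or_eq with hlt | rfl
    · exact absurd hxy (hnc p x r y hlt hxr hry hpr)
    · refine ⟨rfl, ?_⟩
      by_contra hne
      exact (hmax y ⟨⟨hr.1.trans hry, lt_of_le_of_ne hyq hne⟩, hxy⟩).not_gt hry
  · obtain ⟨r, hr, hmin⟩ := Set.exists_min_image _ id (Set.toFinite _) h
    refine ⟨r, hr, fun x y hpx hxr hry hyq hxy => ?_⟩
    rcases hpx.lt_or_eq with hlt | rfl
    · exact absurd (hmin x ⟨hlt, hxr.trans hr.2⟩) hxr.not_ge
    · refine ⟨rfl, ?_⟩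
      by_contra hne
      exact hN ⟨y, ⟨hxr.trans hry, lt_of_le_of_ne hyq hne⟩, hxy⟩

/-- Only the edge `p q` can jump over the split vertex `r`, so the bag `{p, r, q}` joins the
decompositions of the two halves. -/
theorem hasTreeDecomp_Icc
    (hnc : ∀ a b c d : V, a < b → b < c → c < d → G.Adj a c → ¬ G.Adj b d) (n : ℕ) :
    ∀ p q : V, p ≤ q → (Set.Icc p q).ncard ≤ n → HasTreeDecomp G (Set.Icc p q) {p, q} 3 := by
  induction n with
  | zero =>
    intro p q hpq hn
    have : (Set.Icc p q).Nonempty := ⟨p, le_rfl, hpq⟩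
    have := this.ncard_pos
    omega
  | succ n ih =>
    intro p q hpq hn
    by_cases hI : (Set.Ioo p q).Nonempty
    · obtain ⟨r, ⟨hpr, hrq⟩, hsep⟩ := exists_split_vertex hnc hI
      have h1 : (Set.Icc p r).ncard ≤ n := by
        have : (Set.Icc p r).ncard < (Set.Icc p q).ncard := Set.ncard_lt_ncard
          ⟨Set.Icc_subset_Icc_right hrq.le, fun h => (h ⟨hpq, le_rfl⟩ : q ∈ Set.Icc p r).2.not_gt hrq⟩
        omega
      have h2 : (Set.Icc r q).ncard ≤ n := by
        have : (Set.Icc r q).ncard < (Set.Icc p q).ncard := Set.ncard_lt_ncard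
          ⟨Set.Icc_subset_Icc_left hpr.le, fun h => (h ⟨le_rfl, hpq⟩ : p ∈ Set.Icc r q).1.not_gt hpr⟩
        omega
      have g1 := (HasTreeDecomp.single G (ncard_triple_le p r q)).glue (ih p r hpr.le h1)
        Set.inter_subset_left (by
          rintro x ⟨rfl | rfl | rfl, h⟩
          · simp
          · simp
          · exact absurd h.2 hrq.not_ge) (by
          intro x hx y hy hxy
          simp only [Set.mem_union, Set.mem_insert_iff, Set.mem_singleton_iff, Set.mem_Icc]
            at hx hy ⊢
          have := hsep x y
          have := hsep y x
          have := hxy.symm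
          grind)
      have g2 := g1.glue (ih r q hrq.le h2) (by
          rintro x ⟨h | h, h'⟩
          · exact h
          · rw [le_antisymm h.2 h'.1]; simp) (by
          rintro x ⟨(rfl | rfl | rfl) | h, h'⟩
          · exact absurd h'.1 hpr.not_ge
          · simp
          · simp
          · rw [le_antisymm h.2 h'.1]; simp) (by
          intro x hx y hy hxy
          simp only [Set.mem_union, Set.mem_insert_iff, Set.mem_singleton_iff, Set.mem_Icc]
            at hx hy ⊢
          have := hsep x y
          have := hsep y x
          have := hxy.symm
          grind)
      have hX : ({p, r, q} : Set V) ∪ Set.Icc p r ∪ Set.Icc r q = Set.Icc p q := by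
        ext x
        simp only [Set.mem_union, Set.mem_insert_iff, Set.mem_singleton_iff, Set.mem_Icc]
        grind
      rw [hX] at g2
      refine g2.mono ?_
      rintro x (rfl | rfl) <;> simp
    · have hX : Set.Icc p q = {p, q} := by
        ext x
        simp only [Set.mem_insert_iff, Set.mem_singleton_iff, Set.mem_Icc]
        constructor
        · intro hx
          by_contra! hc
          exact hI ⟨x, lt_of_le_of_ne hx.1 hc.1.symm, lt_of_le_of_ne hx.2 hc.2⟩
        · rintro (rfl | rfl)
          · exact ⟨le_rfl, hpq⟩
          · exact ⟨hpq, le_rfl⟩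
      rw [hX]
      refine HasTreeDecomp.single G ?_
      exact (Set.ncard_le_ncard (by intro x hx; exact Or.inr hx)).trans (ncard_triple_le p p q)

/-- A graph drawn on a circle without crossings has treewidth at most 2. -/
theorem treewidth_le_two_of_noncrossing
    (hnc : ∀ a b c d : V, a < b → b < c → c < d → G.Adj a c → ¬ G.Adj b d) :
    treewidth G ≤ 2 := by
  have key : HasTreeDecomp G Set.univ ∅ 3 := by
    rcases isEmpty_or_nonempty V with hV | hV
    · exact (HasTreeDecomp.single G (by simp)).mono (Set.empty_subset _)
    · obtain ⟨p, -, hp⟩ := Set.exists_min_image (Set.univ : Set V) id (Set.toFinite _)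
        Set.univ_nonempty
      obtain ⟨q, -, hq⟩ := Set.exists_max_image (Set.univ : Set V) id (Set.toFinite _)
        Set.univ_nonempty
      have hX : Set.Icc p q = Set.univ := by
        ext x; simpa using ⟨hp x trivial, hq x trivial⟩
      have := hasTreeDecomp_Icc hnc _ p q (hp q trivial) le_rfl
      rw [hX] at this
      exact this.mono (Set.empty_subset _)
  simpa using treewidth_le_of_hasTreeDecomp key
end

/-- Edges of a circular graph whose ends alternate around the circle cross. -/
theorem GeometricGraph.crosses_of_lt {V : Type*} [LinearOrder V] (G : GeometricGraph V) {o : Plane}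
    {r : ℝ} (hs : ∀ v, G.pos v ∈ Metric.sphere o r) (hccw : IsCounterclockwise G.pos)
    {a b c d : V} (hab : a < b) (hbc : b < c) (hcd : c < d) (hac : G.graph.Adj a c)
    (hbd : G.graph.Adj b d) : G.Crosses ⟨s(a, c), hac⟩ ⟨s(b, d), hbd⟩ := by
  obtain ⟨x, hx, h0⟩ := exists_orient_eq_zero
    (mul_neg_of_neg_of_pos (hccw.orient_neg hab hbc) (hccw a c d (hab.trans hbc) hcd))
  have hxbd : x ∈ G.edgeInterior ⟨s(b, d), hbd⟩ := hx
  have hball : x ∈ Metric.closedBall o r :=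
    (convex_closedBall o r).segment_subset (Metric.sphere_subset_closedBall (hs b))
      (Metric.sphere_subset_closedBall (hs d)) (openSegment_subset_segment _ _ _ hx)
  refine ⟨x, ?_, ?_, hxbd⟩
  · intro h
    have h1 : a ∈ (s(b, d) : Sym2 V) := by
      have h2 : (s(a, c) : Sym2 V) = s(b, d) := congrArg Subtype.val h
      rw [← h2]; exact Sym2.mem_mk_left a c
    rcases Sym2.mem_iff.1 h1 with rfl | rfl
    · exact hab.false
    · exact (hab.trans (hbc.trans hcd)).false
  · refine G.mem_edgeInterior_of_orient_eq_zero hs hac hball h0 ?_ ?_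
    · rintro rfl; exact G.pos_notMem_edgeInterior _ _ hxbd
    · rintro rfl; exact G.pos_notMem_edgeInterior _ _ hxbd

/-! ### Polygons of corners, and cutting them along a line -/

/-- A corner of a polygon in the drawing: a point, a vertex on the circle that it is linked to, and
a set of vertices covering all edges that separate the point from the vertex. -/
structure Corner (V : Type*) where
  pt : Plane
  lab : V
  cov : Set V

theorem ncard_cov_union_le {V : Type*} {k : ℕ} {a b : Corner V} {S : Set V} {x y : ℕ} (ha : a.cov.ncard ≤ x)
    (hb : b.cov.ncard ≤ x) (hS : S.ncard ≤ y) (h : 2 * x + y ≤ k) :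
    (a.cov ∪ b.cov ∪ S).ncard ≤ k := by
  have h1 := Set.ncard_union_le (a.cov ∪ b.cov) S
  have h2 := Set.ncard_union_le a.cov b.cov
  omega

/-- A path of corners, in which consecutive corners span disjoint sets of vertices. -/
inductive CornerPath {V : Type*} (C : Corner V → Prop) (S : Corner V → Corner V → Set V → Prop) :
    Corner V → Corner V → Set V → Prop
  | nil {z : Corner V} : C z → CornerPath C S z z ∅
  | cons {z z' y : Corner V} {A B : Set V} : C z → S z z' A → CornerPath C S z' y B →
      Disjoint A B → CornerPath C S z y (A ∪ B)

namespace CornerPath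

variable {V : Type*} {C C' : Corner V → Prop} {S S' : Corner V → Corner V → Set V → Prop}
  {x y z : Corner V} {A B : Set V}

theorem left (h : CornerPath C S x y A) : C x := by
  cases h <;> assumption

theorem right (h : CornerPath C S x y A) : C y := by
  induction h <;> assumption

theorem mono (h : CornerPath C S x y A) (hC : ∀ z, C z → C' z)
    (hS : ∀ z z' A, C z → C z' → S z z' A → S' z z' A) : CornerPath C' S' x y A := by
  induction h with
  | nil h => exact .nil (hC _ h)
  | cons h1 h2 h3 h4 ih => exact .cons (hC _ h1) (hS _ _ _ h1 h3.left h2) ih h4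

theorem append (h : CornerPath C S x y A) (h' : CornerPath C S y z B) (hd : Disjoint A B) :
    CornerPath C S x z (A ∪ B) := by
  induction h with
  | nil h => simpa using h'
  | cons h1 h2 h3 h4 ih =>
    rw [Set.union_assoc]
    rw [Set.disjoint_union_left] at hd
    exact .cons h1 h2 (ih h' hd.2) (Set.disjoint_union_right.2 ⟨h4, hd.1⟩)

theorem single (hx : C x) (hy : C y) (h : S x y A) : CornerPath C S x y A := by
  simpa using CornerPath.cons hx h (.nil hy) (Set.disjoint_empty A)

theorem snoc (h : CornerPath C S x y A) (hz : C z) (hs : S y z B) (hd : Disjoint A B) :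
    CornerPath C S x z (A ∪ B) :=
  h.append (.single h.right hz hs) hd

theorem isArc [LinearOrder V] (h : CornerPath C S x y A)
    (hS : ∀ z z' A, S z z' A → IsArc z.lab z'.lab A) : IsArc x.lab y.lab A := by
  induction h with
  | nil h => exact isArc_empty _
  | cons h1 h2 h3 h4 ih => exact (hS _ _ _ h2).union ih h4

/-- Cutting a closed polygon along a line: if the polygon has corners wherever it meets the line,
and any two corners on the line can be joined by a side in one of the two ways, then there is a
closed polygon on one side of the line. -/
theorem exists_closed_halfplane [LinearOrder V] {ℓ : Corner V → ℝ}
    (hS : ∀ z z' A, S z z' A → IsArc z.lab z'.lab A)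
    (hcut : ∀ a b B, C a → C b → ℓ a = 0 → ℓ b = 0 → IsArc a.lab b.lab B → S a b B ∨ S b a Bᶜ)
    (hx : 0 ≤ ℓ x)
    (h : CornerPath C (fun a b B => S a b B ∧ 0 ≤ ℓ a * ℓ b) y x A) :
    let goal := (∃ z, CornerPath (fun a => C a ∧ 0 ≤ ℓ a) S z z Set.univ) ∨
      ∃ z, CornerPath (fun a => C a ∧ ℓ a ≤ 0) S z z Set.univ
    (∀ A₁, CornerPath (fun a => C a ∧ 0 ≤ ℓ a) S x y A₁ → Disjoint A₁ A → A₁ ∪ A = Set.univ →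
      goal) ∧
    ∀ A₁ A₂ b, CornerPath (fun a => C a ∧ 0 ≤ ℓ a) S x b A₁ → ℓ b = 0 →
      CornerPath (fun a => C a ∧ ℓ a ≤ 0) S b y A₂ → ℓ y < 0 → Disjoint A₁ A₂ →
      Disjoint (A₁ ∪ A₂) A → A₁ ∪ A₂ ∪ A = Set.univ → goal := by
  intro goal
  -- The goal has two clauses for the two states of a walk round the polygon: either the part kept
  -- so far ends on the nonnegative side, or the walk is on an excursion to the negative side that
  -- left the line at `b`.
  induction h with
  | @nil a ha =>
    refine ⟨fun A₁ h1 _ h3 => Or.inl ⟨a, ?_⟩, fun A₁ A₂ b _ _ _ h4 => absurd h4 hx.not_gt⟩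
    rw [Set.union_empty] at h3
    rwa [h3] at h1
  | @cons a a' x A B ha hs hR hd ih =>
    obtain ⟨hs, hsign⟩ := hs
    specialize ih hx
    have ha' := hR.left
    refine ⟨fun A₁ h1 h2 h3 => ?_, fun A₁ A₂ b h1 hb h2 hneg hd1 hd2 hU => ?_⟩
    · rw [Set.disjoint_union_right] at h2
      rw [← Set.union_assoc] at h3
      rcases le_or_gt 0 (ℓ a') with h4 | h4
      · exact ih.1 _ (h1.snoc ⟨ha', h4⟩ hs h2.1) (Set.disjoint_union_left.2 ⟨h2.2, hd⟩) h3
      · have h5 : 0 ≤ ℓ a := h1.right.2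
        -- No side changes sign strictly, so the walk can leave the nonnegative side only at a
        -- corner on the line.
        have h6 : ℓ a = 0 := by nlinarith
        exact ih.2 _ _ a h1 h6 (.single ⟨ha, h6.le⟩ ⟨ha', h4.le⟩ hs) h4 h2.1
          (Set.disjoint_union_left.2 ⟨h2.2, hd⟩) h3
    · rw [Set.disjoint_union_right] at hd2
      have h4 : ℓ a' ≤ 0 := by nlinarith
      have hd3 := Set.disjoint_union_left.1 hd2.1
      have hN := h2.snoc ⟨ha', h4⟩ hs hd3.2
      have hd4 : Disjoint A₁ (A₂ ∪ A) := Set.disjoint_union_right.2 ⟨hd1, hd3.1⟩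
      have hd5 : Disjoint (A₁ ∪ (A₂ ∪ A)) B := by
        rw [← Set.union_assoc]
        exact Set.disjoint_union_left.2 ⟨hd2.2, hd⟩
      have hU' : A₁ ∪ (A₂ ∪ A) ∪ B = Set.univ := by
        rw [← hU]; simp only [Set.union_assoc]
      rcases h4.lt_or_eq with h5 | h5
      · exact ih.2 _ _ b h1 hb hN h5 hd4 hd5 hU'
      -- The excursion returns to the line. Either it is replaced by a side along the line carrying
      -- its arc, or the complement of its arc gives a side that closes the excursion to a polygon.
      · rcases hcut b a' (A₂ ∪ A) h1.right.1 ha' hb h5 (hN.isArc hS) with h6 | h6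
        · exact ih.1 _ (h1.snoc ⟨ha', h5.ge⟩ h6 hd4) hd5 hU'
        · refine Or.inr ⟨b, ?_⟩
          have := hN.snoc hN.left h6 disjoint_compl_right
          rwa [Set.union_compl_self] at this

end CornerPath

/-! ### Covering costs and the invariant of the drawing process -/

/-- The number of vertices needed to cover the edges crossing a path that follows fragments of
colours less than `j`. -/
def pathCost (c m j : ℕ) : ℕ := ∑ i ∈ Finset.range j, (1 + 2 * m * (c - 1 - i))

theorem pathCost_succ (c m j : ℕ) : pathCost c m (j + 1) = pathCost c m j + (1 + 2 * m * (c - 1 - j)) :=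
  Finset.sum_range_succ _ _

theorem pathCost_mono (c m : ℕ) : Monotone (pathCost c m) := fun _ _ h =>
  Finset.sum_le_sum_of_subset (Finset.range_subset_range.2 h)

theorem pathCost_self (c m : ℕ) : pathCost c m c = c + m * (c * (c - 1)) := by
  have h1 : pathCost c m c = c + 2 * m * ∑ i ∈ Finset.range c, (c - 1 - i) := by
    rw [pathCost, Finset.sum_add_distrib, Finset.mul_sum]; simp
  rw [h1, Finset.sum_range_reflect (fun i => i) c, ← Finset.sum_range_id_mul_two c]
  ring

namespace GeometricGraph

variable {V : Type*} (G : GeometricGraph V)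

/-- Every edge avoiding `S` has the point `x` and the vertex `p` strictly on the same side. -/
def Anchored (S : Set V) (x : Plane) (p : V) : Prop :=
  ∀ v w, G.graph.Adj v w → v ∉ S → w ∉ S →
    0 < orient (G.pos v) (G.pos w) x * orient (G.pos v) (G.pos w) (G.pos p)

/-- The corners available once the edges in `E` have been drawn: vertices, and crossings. -/
def IsCorner {c : ℕ} (φ : G.graph.edgeSet → Fin c) (m : ℕ) (E : Set G.graph.edgeSet)
    (z : Corner V) : Prop :=
  G.Anchored z.cov z.pt z.lab ∧ ((z.pt = G.pos z.lab ∧ z.cov = {z.lab}) ∨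
    (0 < m ∧ ∃ f ∈ E, ∃ g ∈ E, φ f < φ g ∧ z.pt ∈ G.edgeInterior f ∧ z.pt ∈ G.edgeInterior g ∧
      z.cov.ncard ≤ pathCost c m (φ f + 1)))

/-- The sides available once the edges in `E` have been drawn: segments that no edge crosses, and
pieces of fragments. The vertices beyond the side form a small arc. -/
def IsSide [LinearOrder V] {c : ℕ} (φ : G.graph.edgeSet → Fin c) (m : ℕ) (small : Set V → Prop)
    (E : Set G.graph.edgeSet) (z z' : Corner V) (A : Set V) : Prop :=
  small A ∧ IsArc z.lab z'.lab A ∧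
    ((∀ v w, G.graph.Adj v w →
        0 ≤ orient (G.pos v) (G.pos w) z.pt * orient (G.pos v) (G.pos w) z'.pt) ∨
      (0 < m ∧ ∃ f ∈ E, z.pt ∈ closedSeg ((f : Sym2 V).map G.pos) ∧
        z'.pt ∈ closedSeg ((f : Sym2 V).map G.pos) ∧ ∃ p S, (p = z.lab ∨ p = z'.lab) ∧
          S.ncard ≤ pathCost c m (φ f + 1) ∧
          ∀ x ∈ openSegment ℝ z.pt z'.pt, G.Anchored S x p))

/-- A circular graph whose fragments are crossed by edges of bounded matching number, with a
consistent notion of small sets of vertices. -/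
structure IsSmallSetting [LinearOrder V] (G : GeometricGraph V) {c : ℕ} (φ : G.graph.edgeSet → Fin c)
    (m k : ℕ) (o : Plane) (r : ℝ) (small : Set V → Prop) : Prop where
  sphere : ∀ v, G.pos v ∈ Metric.sphere o r
  ccw : IsCounterclockwise G.pos
  transparent : G.IsTransparent φ
  matching_le : ∀ i j : Fin c, i < j → ∀ e : G.graph.edgeSet, φ e = i →
    ∀ γ : Set Plane, G.IsFragment φ e γ →
      matchingNumber {f : G.graph.edgeSet | φ f = j ∧ G.CrossesFragment f e γ} ≤ m
  two_le : 2 ≤ k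
  cost_le : 0 < m → 2 * pathCost c m c ≤ k
  subsingleton : ∀ A, A.Subsingleton → small A
  union : ∀ A B, small A → small B → Disjoint A B → HasSmallBoundary G.graph k (A ∪ B) →
    small (A ∪ B)
  small_or : ∀ A, HasSmallBoundary G.graph k A → small A ∨ small Aᶜ
  not_univ : ¬ small Set.univ

/-- The edges in `E` lie weakly on one side of the region `K`. -/
def OneSided (E : Set G.graph.edgeSet) (K : Set Plane) : Prop :=
  ∀ v w (h : G.graph.Adj v w), (⟨s(v, w), h⟩ : G.graph.edgeSet) ∈ E → ∀ a ∈ K, ∀ b ∈ K,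
    0 ≤ orient (G.pos v) (G.pos w) a * orient (G.pos v) (G.pos w) b

end GeometricGraph

/-! ### Corners and fragments on the line of an edge -/

theorem infinite_segment {a b : Plane} (h : a ≠ b) : (segment ℝ a b).Infinite := by
  rw [segment_eq_image_lineMap]
  exact (Set.Icc_infinite zero_lt_one).image (AffineMap.lineMap_injective ℝ h).injOn

theorem openSegment_subset_openSegment_of_mem {a b x : Plane} (hx : x ∈ openSegment ℝ a b) :
    openSegment ℝ a x ⊆ openSegment ℝ a b := by
  obtain ⟨s, t, hs, ht, hst, rfl⟩ := hx
  rintro _ ⟨s', t', hs', ht', hst', rfl⟩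
  refine ⟨s' + t' * s, t' * t, by positivity, by positivity, ?_, ?_⟩
  · linear_combination hst' + t' * hst
  · module

namespace GeometricGraph.IsSmallSetting

variable {V : Type*} [LinearOrder V] {G : GeometricGraph V} {c m k : ℕ}
  {φ : G.graph.edgeSet → Fin c} {o : Plane} {r : ℝ} {small : Set V → Prop}

section
variable (H : G.IsSmallSetting φ m k o r small)
include H

theorem pos_mem_closedBall (v : V) : G.pos v ∈ Metric.closedBall o r :=
  Metric.sphere_subset_closedBall (H.sphere v)

theorem closedSeg_subset (e : Sym2 V) : closedSeg (e.map G.pos) ⊆ Metric.closedBall o r := by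
  induction e with
  | _ v w =>
    exact (convex_closedBall o r).segment_subset (H.pos_mem_closedBall v) (H.pos_mem_closedBall w)

theorem ne_pos_of_mem_openSegment {a b x : Plane} (ha : a ∈ Metric.closedBall o r)
    (hb : b ∈ Metric.closedBall o r) (hab : a ≠ b) (hx : x ∈ openSegment ℝ a b) (v : V) :
    x ≠ G.pos v := by
  rintro rfl
  have h1 := openSegment_subset_ball_of_ne ha hb hab hx
  exact (Metric.mem_ball.1 h1).ne (Metric.mem_sphere.1 (H.sphere v))

theorem mem_edgeInterior_of_mem_openSegment (f : G.graph.edgeSet) {a b x : Plane}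
    (ha : a ∈ closedSeg ((f : Sym2 V).map G.pos)) (hb : b ∈ closedSeg ((f : Sym2 V).map G.pos))
    (hab : a ≠ b) (hx : x ∈ openSegment ℝ a b) : x ∈ G.edgeInterior f := by
  have hne := H.ne_pos_of_mem_openSegment (H.closedSeg_subset _ ha) (H.closedSeg_subset _ hb) hab hx
  obtain ⟨⟨v, w⟩, h⟩ := f
  exact mem_openSegment_of_ne_left_right (hne v).symm (hne w).symm
    ((convex_segment _ _).segment_subset ha hb (openSegment_subset_segment _ _ _ hx))

/-- A corner on the line of the edge `e` splits `e`. -/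
theorem mem_splitPoints {E : Set G.graph.edgeSet} {u w : V} (h : G.graph.Adj u w)
    (hE : ∀ f ∈ E, φ f ≤ φ ⟨s(u, w), h⟩) {z : Corner V}
    (hz : G.IsCorner φ m (insert ⟨s(u, w), h⟩ E) z) (hball : z.pt ∈ Metric.closedBall o r)
    (h0 : orient (G.pos u) (G.pos w) z.pt = 0) :
    z.pt ∈ G.splitPoints φ ⟨s(u, w), h⟩ ∧ ∃ S : Set V, z.cov ⊆ S ∧ (u ∈ S ∨ w ∈ S) ∧
      S.ncard ≤ pathCost c m (φ ⟨s(u, w), h⟩) + 1 := by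
  set e : G.graph.edgeSet := ⟨s(u, w), h⟩ with he
  rcases hz.2 with ⟨h1, h2⟩ | ⟨hm, f, hf, g, hg, hfg, hzf, hzg, hcard⟩
  · have hseg := mem_segment_of_orient_eq_zero (H.sphere u) (H.sphere w)
      (fun e => h.ne (G.pos_injective e)) hball h0
    rw [h1] at hseg
    have hmem : z.lab ∈ (e : Sym2 V) := G.mem_of_pos_mem e e.2 _ hseg
    refine ⟨Or.inl ⟨z.lab, hmem, h1⟩, z.cov, subset_rfl, ?_, ?_⟩
    · rw [h2]
      rcases Sym2.mem_iff.1 hmem with h3 | h3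
      · exact Or.inl h3.symm
      · exact Or.inr h3.symm
    · rw [h2, Set.ncard_singleton]; omega
  · have hne : ∀ v, z.pt ≠ G.pos v := fun v hv => G.pos_notMem_edgeInterior f v (hv ▸ hzf)
    have hze : z.pt ∈ G.edgeInterior e :=
      G.mem_edgeInterior_of_orient_eq_zero H.sphere h hball h0 (hne u) (hne w)
    -- If `e` were the edge of smaller colour at the crossing, `g` would have colour larger than
    -- `e`, but such edges are not yet drawn.
    have hfe : f ≠ e := by
      rintro rfl
      rcases hg with rfl | hg
      · exact hfg.false
      · exact (hE g hg).not_gt hfg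
    have hge : g = e := by
      by_contra hge
      have hfg' : f ≠ g := fun hh => by rw [hh] at hfg; exact hfg.false
      have h3 := G.no_triple_point f f.2 g g.2 e e.2 (fun hh => hfg' (Subtype.ext hh))
        (fun hh => hge (Subtype.ext hh)) (fun hh => hfe (Subtype.ext hh))
      exact Set.notMem_empty z.pt (h3 ▸ ⟨⟨hzf, hzg⟩, hze⟩)
    subst hge
    -- Adding the end `u` hits `e` itself; the rest of the cover belongs to the smaller colour of
    -- `f`.
    refine ⟨Or.inr ⟨f, hfg, hfe.symm, hzg, hzf⟩, insert u z.cov, Set.subset_insert _ _,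
      Or.inl (Set.mem_insert _ _), (Set.ncard_insert_le _ _).trans ?_⟩
    have := pathCost_mono c m (show (φ f : ℕ) + 1 ≤ φ e from hfg)
    omega

/-- Two corners on the line of the edge `e` span a fragment of `e`. -/
theorem isFragment {E : Set G.graph.edgeSet} {u w : V} (h : G.graph.Adj u w)
    (hE : ∀ f ∈ E, φ f ≤ φ ⟨s(u, w), h⟩) (hE' : ∀ f ∉ E, φ ⟨s(u, w), h⟩ ≤ φ f) {K : Set Plane}
    (hK : G.OneSided E K) (hKb : K ⊆ Metric.closedBall o r) {a b : Corner V}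
    (ha : G.IsCorner φ m (insert ⟨s(u, w), h⟩ E) a) (hb : G.IsCorner φ m (insert ⟨s(u, w), h⟩ E) b)
    (haK : a.pt ∈ K) (hbK : b.pt ∈ K) (ha0 : orient (G.pos u) (G.pos w) a.pt = 0)
    (hb0 : orient (G.pos u) (G.pos w) b.pt = 0) (hab : a.pt ≠ b.pt) :
    Disjoint (openSegment ℝ a.pt b.pt) (G.splitPoints φ ⟨s(u, w), h⟩) ∧
      G.IsFragment φ ⟨s(u, w), h⟩ (segment ℝ a.pt b.pt) := by
  suffices hdis : Disjoint (openSegment ℝ a.pt b.pt) (G.splitPoints φ ⟨s(u, w), h⟩) from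
    ⟨hdis, _, (H.mem_splitPoints h hE ha (hKb haK) ha0).1, _,
      (H.mem_splitPoints h hE hb (hKb hbK) hb0).1, hab, hdis, rfl⟩
  rw [Set.disjoint_left]
  rintro x hx (⟨v, -, rfl⟩ | ⟨f, hlt, hne, hxe, hxf⟩)
  · exact H.ne_pos_of_mem_openSegment (hKb haK) (hKb hbK) hab hx v rfl
  · have hfE : f ∈ E := by
      by_contra hf
      exact (hE' f hf).not_gt hlt
    obtain ⟨⟨p, q⟩, hpq⟩ := f
    have hxf' : x ∈ openSegment ℝ (G.pos p) (G.pos q) := hxf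
    -- The two corners are weakly on one side of `f`, yet `f` meets the open segment between them;
    -- so both lie on the line of `f`, and `e` and `f` would share a whole segment.
    obtain ⟨h1, h2⟩ := orient_eq_zero_of_mem_openSegment hx
      (orient_eq_zero_of_mem_segment (openSegment_subset_segment _ _ _ hxf'))
      (hK p q hpq hfE _ haK _ hbK)
    have seg : ∀ {v w : V}, G.graph.Adj v w → orient (G.pos v) (G.pos w) a.pt = 0 →
        orient (G.pos v) (G.pos w) b.pt = 0 → segment ℝ a.pt b.pt ⊆ segment ℝ (G.pos v) (G.pos w) :=
      fun hvw e1 e2 => (convex_segment _ _).segment_subset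
        (mem_segment_of_orient_eq_zero (H.sphere _) (H.sphere _)
          (fun e => hvw.ne (G.pos_injective e)) (hKb haK) e1)
        (mem_segment_of_orient_eq_zero (H.sphere _) (H.sphere _)
          (fun e => hvw.ne (G.pos_injective e)) (hKb hbK) e2)
    exact infinite_segment hab ((G.finite_inter s(u, w) h _ hpq fun hh => hne (Subtype.ext hh)).subset
      (Set.subset_inter (seg h ha0 hb0) (seg hpq h1 h2)))

/-- An arc between two corners has a small boundary if few vertices cover the edges separating the
corners. -/
theorem hasSmallBoundary {E : Set G.graph.edgeSet} {a b : Corner V} (ha : G.IsCorner φ m E a)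
    (hb : G.IsCorner φ m E b) {B : Set V} (hB : IsArc a.lab b.lab B) {S : Set V}
    (hS : (a.cov ∪ b.cov ∪ S).ncard ≤ k)
    (hcov : ∀ v w, G.graph.Adj v w → v ∉ S → w ∉ S →
      0 ≤ orient (G.pos v) (G.pos w) a.pt * orient (G.pos v) (G.pos w) b.pt) :
    HasSmallBoundary G.graph k B := by
  refine ⟨_, hS, fun v w hvw hv hw => ?_⟩
  by_contra! hc
  simp only [Set.mem_union, not_or] at hc
  obtain ⟨⟨⟨va, vb⟩, vS⟩, ⟨wa, wb⟩, wS⟩ := hc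
  have h1 := ha.1 v w hvw va wa
  have h2 := hb.1 v w hvw vb wb
  have hva : v ≠ a.lab := by
    rintro rfl
    rw [orient_left, mul_zero] at h1
    exact h1.false
  have hwb : w ≠ b.lab := by
    rintro rfl
    rw [orient_right, mul_zero] at h2
    exact h2.false
  -- An uncovered edge leaving the arc separates the two labels, hence, by anchoring, the two corner
  -- points.
  exact (hcov v w hvw vS wS).not_gt
    (mul_neg_of_mul_pos h1 h2 (H.ccw.orient_mul_neg_of_isArc hB hv hw hva hwb))

variable [Finite V]

/-- The edges of larger colour crossing a fragment can be covered by few vertices. -/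
theorem exists_fragment_cover {e : G.graph.edgeSet} {γ : Set Plane} (hγ : G.IsFragment φ e γ) :
    ∃ S : Set V, S.ncard ≤ 2 * m * (c - 1 - φ e) ∧
      ∀ f, φ e < φ f → G.CrossesFragment f e γ → ∃ v ∈ S, v ∈ (f : Sym2 V) := by
  have hj : ∀ j, ∃ S : Set V, S.ncard ≤ 2 * m ∧
      (φ e < j → ∀ f, φ f = j → G.CrossesFragment f e γ → ∃ v ∈ S, v ∈ (f : Sym2 V)) := by
    intro j
    by_cases hlt : φ e < j
    · obtain ⟨S, h1, h2⟩ := exists_cover_of_matchingNumber_le (H.matching_le _ j hlt e rfl γ hγ)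
      exact ⟨S, h1, fun _ f hf hc => h2 f ⟨hf, hc⟩⟩
    · exact ⟨∅, by simp, fun h => absurd h hlt⟩
  choose S hS hcov using hj
  refine ⟨⋃ j ∈ Finset.Ioi (φ e), S j, ?_, fun f hf hc => ?_⟩
  · have h1 : (⋃ j ∈ Finset.Ioi (φ e), S j).ncard ≤ ∑ j ∈ Finset.Ioi (φ e), (S j).ncard :=
      Finset.set_ncard_biUnion_le _ _
    refine h1.trans ((Finset.sum_le_card_nsmul _ _ (2 * m) fun j _ => hS j).trans ?_)
    rw [Fin.card_Ioi, smul_eq_mul, mul_comm]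
  · obtain ⟨v, hv, hvf⟩ := hcov (φ f) hf f rfl hc
    exact ⟨v, Set.mem_biUnion (Finset.mem_coe.2 (Finset.mem_Ioi.2 hf)) hv, hvf⟩

/-- The vertices needed to cover the edges through the interior of a fragment. -/
theorem exists_openSegment_cover {u w : V} (h : G.graph.Adj u w) {a b : Plane}
    (ha : a ∈ closedSeg ((s(u, w) : Sym2 V).map G.pos))
    (hb : b ∈ closedSeg ((s(u, w) : Sym2 V).map G.pos))
    (hab : a ≠ b) (hdis : Disjoint (openSegment ℝ a b) (G.splitPoints φ ⟨s(u, w), h⟩))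
    (hfrag : G.IsFragment φ ⟨s(u, w), h⟩ (segment ℝ a b)) :
    ∃ S : Set V, S.ncard ≤ 2 * m * (c - 1 - φ ⟨s(u, w), h⟩) ∧
      ∀ x ∈ openSegment ℝ a b, ∀ v v', G.graph.Adj v v' → v ∉ S → v' ∉ S → s(v, v') ≠ s(u, w) →
        orient (G.pos v) (G.pos v') x ≠ 0 := by
  obtain ⟨S, hS, hcov⟩ := H.exists_fragment_cover hfrag
  refine ⟨S, hS, fun x hx v v' hvv hv hv' hne h0 => ?_⟩
  have hxe : x ∈ G.edgeInterior ⟨s(u, w), h⟩ := H.mem_edgeInterior_of_mem_openSegment _ ha hb hab hx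
  have hball := (convex_closedBall o r).segment_subset (H.closedSeg_subset _ ha)
    (H.closedSeg_subset _ hb) (openSegment_subset_segment _ _ _ hx)
  have hxne := H.ne_pos_of_mem_openSegment (H.closedSeg_subset _ ha) (H.closedSeg_subset _ hb) hab hx
  have hxf := G.mem_edgeInterior_of_orient_eq_zero H.sphere hvv hball h0 (hxne v) (hxne v')
  have hne' : (⟨s(u, w), h⟩ : G.graph.edgeSet) ≠ ⟨s(v, v'), hvv⟩ :=
    fun hh => hne (congrArg Subtype.val hh).symm
  have hcross : x ∈ G.crossings ⟨s(u, w), h⟩ ⟨s(v, v'), hvv⟩ := ⟨hne', hxe, hxf⟩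
  -- Crossings with larger colours are covered, with the same colour are excluded by transparency,
  -- and with smaller colours are split points.
  rcases lt_trichotomy (φ ⟨s(u, w), h⟩) (φ ⟨s(v, v'), hvv⟩) with hlt | heq | hgt
  · obtain ⟨y, hy, hyf⟩ := hcov _ hlt ⟨x, hcross, openSegment_subset_segment _ _ _ hx⟩
    rcases Sym2.mem_iff.1 hyf with rfl | rfl
    · exact hv hy
    · exact hv' hy
  · exact H.transparent _ _ heq ⟨x, hcross⟩
  · exact Set.disjoint_left.1 hdis hx (Or.inr ⟨_, hgt, hcross⟩)
end

end GeometricGraph.IsSmallSetting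

/-! ### Drawing the edges one at a time -/

namespace GeometricGraph

variable {V : Type*} {G : GeometricGraph V} {c m : ℕ} {φ : G.graph.edgeSet → Fin c}

theorem IsCorner.mono {E E' : Set G.graph.edgeSet} (hE : E ⊆ E') {z : Corner V}
    (h : G.IsCorner φ m E z) : G.IsCorner φ m E' z := by
  refine ⟨h.1, h.2.imp_right ?_⟩
  rintro ⟨hm, f, hf, g, hg, h⟩
  exact ⟨hm, f, hE hf, g, hE hg, h⟩

/-- For `m = 0` only vertices serve as corners, so two single vertices replace the two links; hence
`two_le` suffices there and `cost_le` is needed only for positive `m`. -/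
theorem IsCorner.ncard_cov_le_one {E : Set G.graph.edgeSet} (hm : ¬ 0 < m) {z : Corner V}
    (h : G.IsCorner φ m E z) : z.cov.ncard ≤ 1 := by
  rcases h.2 with ⟨-, h⟩ | ⟨h, -⟩
  · rw [h, Set.ncard_singleton]
  · exact absurd h hm

theorem IsCorner.ncard_cov_le {E : Set G.graph.edgeSet} {z : Corner V}
    (h : G.IsCorner φ m E z) (hc : 1 ≤ c) : z.cov.ncard ≤ pathCost c m c := by
  rcases h.2 with ⟨-, h⟩ | ⟨-, f, -, -, -, -, -, -, h⟩
  · rw [h, Set.ncard_singleton, pathCost_self]; omega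
  · exact h.trans (pathCost_mono c m (φ f).2)

theorem IsSide.mono [LinearOrder V] {small : Set V → Prop} {E E' : Set G.graph.edgeSet}
    (hE : E ⊆ E') {z z' : Corner V} {A : Set V} (h : G.IsSide φ m small E z z' A) :
    G.IsSide φ m small E' z z' A := by
  obtain ⟨h1, h2, h3⟩ := h
  refine ⟨h1, h2, h3.imp_right ?_⟩
  rintro ⟨hm, f, hf, h⟩
  exact ⟨hm, f, hE hf, h⟩

namespace IsSmallSetting

variable [LinearOrder V] {k : ℕ} {o : Plane} {r : ℝ} {small : Set V → Prop}

section
variable (H : G.IsSmallSetting φ m k o r small)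
include H

/-- A side can be subdivided where it crosses the edge `e`. -/
theorem exists_refined_side {E : Set G.graph.edgeSet} {u w : V} (h : G.graph.Adj u w)
    (hE : ∀ f ∈ E, φ f ≤ φ ⟨s(u, w), h⟩) {K : Set Plane} (hKc : Convex ℝ K)
    (hKb : K ⊆ Metric.closedBall o r) {a b : Corner V} (haK : a.pt ∈ K) (hbK : b.pt ∈ K)
    (ha : G.IsCorner φ m E a) (hb : G.IsCorner φ m E b) {A : Set V}
    (hs : G.IsSide φ m small E a b A) :
    CornerPath (fun z => G.IsCorner φ m (insert ⟨s(u, w), h⟩ E) z ∧ z.pt ∈ K)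
      (fun z z' A => G.IsSide φ m small (insert ⟨s(u, w), h⟩ E) z z' A ∧
        0 ≤ orient (G.pos u) (G.pos w) z.pt * orient (G.pos u) (G.pos w) z'.pt) a b A := by
  set e : G.graph.edgeSet := ⟨s(u, w), h⟩ with he
  have hsub : E ⊆ insert e E := Set.subset_insert _ _
  by_cases hsign : 0 ≤ orient (G.pos u) (G.pos w) a.pt * orient (G.pos u) (G.pos w) b.pt
  · exact .single ⟨ha.mono hsub, haK⟩ ⟨hb.mono hsub, hbK⟩ ⟨hs.mono hsub, hsign⟩
  rw [not_le] at hsign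
  obtain ⟨hsmall, harc, hcut | ⟨hm, f, hf, haf, hbf, p, S, hp, hS, hanch⟩⟩ := hs
  · exact absurd (hcut u w h) hsign.not_ge
  obtain ⟨x, hx, hx0⟩ := exists_orient_eq_zero hsign
  have hab : a.pt ≠ b.pt := by
    intro hab
    rw [hab] at hsign
    exact (mul_self_nonneg _).not_gt hsign
  have hxK : x ∈ K := hKc.segment_subset haK hbK (openSegment_subset_segment _ _ _ hx)
  have hxne := H.ne_pos_of_mem_openSegment (hKb haK) (hKb hbK) hab hx
  have hxf := H.mem_edgeInterior_of_mem_openSegment f haf hbf hab hx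
  have hxe : x ∈ G.edgeInterior e :=
    G.mem_edgeInterior_of_orient_eq_zero H.sphere h (hKb hxK) hx0 (hxne u) (hxne w)
  have hfe : f ≠ e := by
    rintro rfl
    rw [orient_eq_zero_of_mem_segment (p := G.pos u) (q := G.pos w) haf, zero_mul] at hsign
    exact hsign.false
  have hlt : φ f < φ e := lt_of_le_of_ne (hE f hf) fun heq =>
    H.transparent f e heq ⟨x, hfe, hxf, hxe⟩
  -- The crossing inherits the anchor and cover of the side. As its label `p` is the label of one
  -- end, one piece of the side gets the empty arc and the other gets all of `A`.
  let z : Corner V := ⟨x, p, S⟩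
  have hz : G.IsCorner φ m (insert e E) z ∧ z.pt ∈ K :=
    ⟨⟨hanch x hx, Or.inr ⟨hm, f, hsub hf, e, Set.mem_insert _ _, hlt, hxf, hxe, hS⟩⟩, hxK⟩
  have hxcl : x ∈ closedSeg ((f : Sym2 V).map G.pos) := openSeg_subset_closedSeg _ hxf
  have side₁ : ∀ A, small A → IsArc a.lab p A →
      G.IsSide φ m small (insert e E) a z A ∧
        0 ≤ orient (G.pos u) (G.pos w) a.pt * orient (G.pos u) (G.pos w) z.pt :=
    fun A h1 h2 => ⟨⟨h1, h2, Or.inr ⟨hm, f, hsub hf, haf, hxcl, p, S, Or.inr rfl, hS,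
      fun y hy => hanch y (openSegment_subset_openSegment_of_mem hx hy)⟩⟩,
      by rw [show z.pt = x from rfl, hx0, mul_zero]⟩
  have side₂ : ∀ A, small A → IsArc p b.lab A →
      G.IsSide φ m small (insert e E) z b A ∧
        0 ≤ orient (G.pos u) (G.pos w) z.pt * orient (G.pos u) (G.pos w) b.pt :=
    fun A h1 h2 => ⟨⟨h1, h2, Or.inr ⟨hm, f, hsub hf, hxcl, hbf, p, S, Or.inl rfl, hS,
      fun y hy => hanch y (by
        rw [openSegment_symm] at hx hy ⊢
        exact openSegment_subset_openSegment_of_mem hx hy)⟩⟩,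
      by rw [show z.pt = x from rfl, hx0, zero_mul]⟩
  have hempty : small ∅ := H.subsingleton _ Set.subsingleton_empty
  have ha' : G.IsCorner φ m (insert e E) a ∧ a.pt ∈ K := ⟨ha.mono hsub, haK⟩
  have hb' : G.IsCorner φ m (insert e E) b ∧ b.pt ∈ K := ⟨hb.mono hsub, hbK⟩
  rcases hp with hp | hp
  · have h1 := side₁ ∅ hempty (hp ▸ isArc_empty _)
    have h2 := side₂ A hsmall (by rw [hp]; exact harc)
    simpa using CornerPath.cons ha' h1 (.single hz hb' h2) (Set.empty_disjoint A)
  · have h1 := side₁ A hsmall (by rw [hp]; exact harc)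
    have h2 := side₂ ∅ hempty (hp ▸ isArc_empty _)
    simpa using CornerPath.cons ha' h1 (.single hz hb' h2) (Set.disjoint_empty A)

variable [Finite V]

/-- Cutting a polygon between two corners on the line of the edge `e`. -/
theorem small_side_or {E : Set G.graph.edgeSet} {u w : V} (h : G.graph.Adj u w)
    (hE : ∀ f ∈ E, φ f ≤ φ ⟨s(u, w), h⟩) (hE' : ∀ f ∉ E, φ ⟨s(u, w), h⟩ ≤ φ f) {K : Set Plane}
    (hK : G.OneSided E K) (hKb : K ⊆ Metric.closedBall o r) {a b : Corner V}
    (ha : G.IsCorner φ m (insert ⟨s(u, w), h⟩ E) a) (hb : G.IsCorner φ m (insert ⟨s(u, w), h⟩ E) b)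
    (haK : a.pt ∈ K) (hbK : b.pt ∈ K) (ha0 : orient (G.pos u) (G.pos w) a.pt = 0)
    (hb0 : orient (G.pos u) (G.pos w) b.pt = 0) {B : Set V} (hB : IsArc a.lab b.lab B) :
    HasSmallBoundary G.graph k B ∧
      (small B → G.IsSide φ m small (insert ⟨s(u, w), h⟩ E) a b B) := by
  set e : G.graph.edgeSet := ⟨s(u, w), h⟩ with he
  have hc : 1 ≤ c := (Nat.zero_le _).trans_lt (φ e).2
  obtain ⟨Sa, haS, hae, haC⟩ := (H.mem_splitPoints h hE ha (hKb haK) ha0).2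
  obtain ⟨Sb, hbS, hbe, hbC⟩ := (H.mem_splitPoints h hE hb (hKb hbK) hb0).2
  rw [← he] at haC hbC
  by_cases hab : a.pt = b.pt
  · have hcov : ∀ v w, G.graph.Adj v w →
        0 ≤ orient (G.pos v) (G.pos w) a.pt * orient (G.pos v) (G.pos w) b.pt := by
      intro v w _
      rw [hab]
      exact mul_self_nonneg _
    refine ⟨H.hasSmallBoundary ha hb hB (S := ∅) ?_ fun v w hvw _ _ => hcov v w hvw,
      fun hs => ⟨hs, hB, Or.inl hcov⟩⟩
    by_cases hm : 0 < m
    · refine ncard_cov_union_le (ha.ncard_cov_le hc) (hb.ncard_cov_le hc) (y := 0) (by simp) ?_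
      have := H.cost_le hm
      omega
    · exact ncard_cov_union_le (ha.ncard_cov_le_one hm) (hb.ncard_cov_le_one hm) (y := 0) (by simp)
        H.two_le
  · obtain ⟨hdis, hfrag⟩ := H.isFragment h hE hE' hK hKb ha hb haK hbK ha0 hb0 hab
    have haseg := mem_segment_of_orient_eq_zero (H.sphere u) (H.sphere w)
      (fun e => h.ne (G.pos_injective e)) (hKb haK) ha0
    have hbseg := mem_segment_of_orient_eq_zero (H.sphere u) (H.sphere w)
      (fun e => h.ne (G.pos_injective e)) (hKb hbK) hb0
    obtain ⟨S, hS, hcov⟩ := H.exists_openSegment_cover h haseg hbseg hab hdis hfrag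
    rw [← he] at hS
    have hcov' : ∀ v v', G.graph.Adj v v' → v ∉ S → v' ∉ S →
        0 ≤ orient (G.pos v) (G.pos v') a.pt * orient (G.pos v) (G.pos v') b.pt := by
      intro v v' hvv hv hv'
      by_contra! hlt
      obtain ⟨x, hx, h0⟩ := exists_orient_eq_zero hlt
      refine hcov x hx v v' hvv hv hv' ?_ h0
      intro heq
      rcases Sym2.eq_iff.1 heq with ⟨rfl, rfl⟩ | ⟨rfl, rfl⟩
      · rw [ha0, zero_mul] at hlt
        exact hlt.false
      · rw [orient_swap, ha0, neg_zero, zero_mul] at hlt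
        exact hlt.false
    refine ⟨H.hasSmallBoundary ha hb hB (S := S) ?_ hcov', fun hs => ⟨hs, hB, ?_⟩⟩
    · by_cases hm : 0 < m
      -- The count is `2(pathCost c m (φ e) + 1) + 2m(c - 1 - φ e)`, which is at most `2 pathCost c
      -- m (φ e + 1) ≤ k`.
      · refine ncard_cov_union_le ((Set.ncard_le_ncard haS).trans haC)
          ((Set.ncard_le_ncard hbS).trans hbC) hS ?_
        have h1 := pathCost_succ c m (φ e)
        have h2 := pathCost_mono c m (show (φ e : ℕ) + 1 ≤ c from (φ e).2)
        have h3 := H.cost_le hm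
        omega
      · refine ncard_cov_union_le (ha.ncard_cov_le_one hm) (hb.ncard_cov_le_one hm) hS ?_
        have hm0 : m = 0 := by omega
        rw [hm0]
        simpa using H.two_le
    · by_cases hm : 0 < m
      -- The new side is anchored at the label of `a`. The cover `Sa` reaches that label and
      -- contains an end of `e`, while `S` pays for moving along the fragment.
      · refine Or.inr ⟨hm, e, Set.mem_insert _ _, haseg, hbseg, a.lab, Sa ∪ S, Or.inl rfl, ?_, ?_⟩
        · have h1 := pathCost_succ c m (φ e)
          have h2 := Set.ncard_union_le Sa S
          omega
        · intro x hx v v' hvv hv hv'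
          simp only [Set.mem_union, not_or] at hv hv'
          have hne : s(v, v') ≠ s(u, w) := by
            intro heq
            rcases Sym2.eq_iff.1 heq with ⟨rfl, rfl⟩ | ⟨rfl, rfl⟩
            · exact hae.elim hv.1 hv'.1
            · exact hae.elim hv'.1 hv.1
          have h1 := ha.1 v v' hvv (fun h => hv.1 (haS h)) (fun h => hv'.1 (haS h))
          have h2 : 0 < orient (G.pos v) (G.pos v') a.pt * orient (G.pos v) (G.pos v') x := by
            -- An edge separating `a` from `x` would meet the fragment between them, contradicting
            -- the choice of `S`.
            by_contra! hle
            have hx0 := hcov x hx v v' hvv hv.2 hv'.2 hne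
            have ha0' : orient (G.pos v) (G.pos v') a.pt ≠ 0 := by
              intro h0
              rw [h0, zero_mul] at h1
              exact h1.false
            obtain ⟨y, hy, hy0⟩ := exists_orient_eq_zero
              (lt_of_le_of_ne hle (mul_ne_zero ha0' hx0))
            exact hcov y (openSegment_subset_openSegment_of_mem hx hy) v v' hvv hv.2 hv'.2 hne hy0
          by_contra! hle
          have h3 := mul_pos h1 h2
          have h4 := mul_self_nonneg (orient (G.pos v) (G.pos v') a.pt)
          nlinarith [mul_nonneg h4 (neg_nonneg.2 hle)]
      · have hS0 : S = ∅ := by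
          have hm0 : m = 0 := by omega
          rw [hm0] at hS
          exact (Set.ncard_eq_zero).1 (by simpa using hS)
        refine Or.inl fun v v' hvv => hcov' v v' hvv ?_ ?_ <;> simp [hS0]

/-- Drawing one more edge keeps a closed polygon all of whose sides span small sets. -/
theorem exists_polygon_insert {E : Set G.graph.edgeSet} {e : G.graph.edgeSet}
    (hE : ∀ f ∈ E, φ f ≤ φ e) (hE' : ∀ f ∉ E, φ e ≤ φ f)
    (h : ∃ K, Convex ℝ K ∧ K ⊆ Metric.closedBall o r ∧ G.OneSided E K ∧ ∃ z,
      CornerPath (fun z => G.IsCorner φ m E z ∧ z.pt ∈ K) (G.IsSide φ m small E) z z Set.univ) :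
    ∃ K, Convex ℝ K ∧ K ⊆ Metric.closedBall o r ∧ G.OneSided (insert e E) K ∧ ∃ z,
      CornerPath (fun z => G.IsCorner φ m (insert e E) z ∧ z.pt ∈ K)
        (G.IsSide φ m small (insert e E)) z z Set.univ := by
  obtain ⟨K, hKc, hKb, hK, z, hz⟩ := h
  -- The ends of `e` are named so that the starting corner is on the nonnegative side.
  obtain ⟨u, w, h, rfl, h0⟩ : ∃ u w, ∃ h : G.graph.Adj u w, e = ⟨s(u, w), h⟩ ∧
      0 ≤ orient (G.pos u) (G.pos w) z.pt := by
    obtain ⟨⟨u, w⟩, h⟩ := e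
    rcases le_total 0 (orient (G.pos u) (G.pos w) z.pt) with h0 | h0
    · exact ⟨u, w, h, rfl, h0⟩
    · refine ⟨w, u, h.symm, Subtype.ext Sym2.eq_swap, ?_⟩
      rw [orient_swap]; linarith
  set e : G.graph.edgeSet := ⟨s(u, w), h⟩ with he
  have hone : ∀ K' ⊆ K, (∀ a ∈ K', ∀ b ∈ K',
      0 ≤ orient (G.pos u) (G.pos w) a * orient (G.pos u) (G.pos w) b) →
      G.OneSided (insert e E) K' := by
    intro K' hK' hsign v v' hvv hmem a ha b hb
    rcases hmem with heq | hmem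
    · rcases Sym2.eq_iff.1 (congrArg Subtype.val heq) with ⟨rfl, rfl⟩ | ⟨rfl, rfl⟩
      · exact hsign a ha b hb
      · rw [orient_swap, orient_swap _ _ b, neg_mul_neg]
        exact hsign a ha b hb
    · exact hK v v' hvv hmem a (hK' ha) b (hK' hb)
  have href : ∀ {x y A}, CornerPath (fun z => G.IsCorner φ m E z ∧ z.pt ∈ K)
      (G.IsSide φ m small E) x y A →
      CornerPath (fun z => G.IsCorner φ m (insert e E) z ∧ z.pt ∈ K)
        (fun z z' A => G.IsSide φ m small (insert e E) z z' A ∧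
          0 ≤ orient (G.pos u) (G.pos w) z.pt * orient (G.pos u) (G.pos w) z'.pt) x y A := by
    intro x y A hp
    induction hp with
    | nil h => exact .nil ⟨h.1.mono (Set.subset_insert _ _), h.2⟩
    | cons h1 h2 h3 h4 ih =>
      exact (H.exists_refined_side h hE hKc hKb h1.2 h3.left.2 h1.1 h3.left.1 h2).append ih h4
  have hcut := (CornerPath.exists_closed_halfplane
    (ℓ := fun z => orient (G.pos u) (G.pos w) z.pt) (fun z z' A h => h.2.1)
    (fun a b B ha hb ha0 hb0 hB => by
      obtain ⟨h1, h2⟩ := H.small_side_or h hE hE' hK hKb ha.1 hb.1 ha.2 hb.2 ha0 hb0 hB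
      obtain ⟨-, h3⟩ := H.small_side_or h hE hE' hK hKb hb.1 ha.1 hb.2 ha.2 hb0 ha0 hB.compl
      exact (H.small_or B h1).imp h2 h3) h0 (href hz)).1 ∅
    (.nil ⟨(href hz).left, h0⟩) (Set.empty_disjoint _) (by simp)
  rcases hcut with ⟨z', hz'⟩ | ⟨z', hz'⟩
  · refine ⟨K ∩ {x | 0 ≤ orient (G.pos u) (G.pos w) x}, hKc.inter (convex_orient_nonneg _ _),
      Set.inter_subset_left.trans hKb, hone _ Set.inter_subset_left
        fun a ha b hb => mul_nonneg ha.2 hb.2, z', hz'.mono (fun z h => ⟨h.1.1, h.1.2, h.2⟩)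
        fun _ _ _ _ _ h => h⟩
  · refine ⟨K ∩ {x | orient (G.pos u) (G.pos w) x ≤ 0}, hKc.inter (convex_orient_nonpos _ _),
      Set.inter_subset_left.trans hKb, hone _ Set.inter_subset_left
        fun a ha b hb => mul_nonneg_of_nonpos_of_nonpos ha.2 hb.2, z',
        hz'.mono (fun z h => ⟨h.1.1, h.1.2, h.2⟩) fun _ _ _ _ _ h => h⟩

/-- The polygon formed by the points on the circle. -/
theorem exists_polygon_empty [Nonempty V] :
    ∃ K, Convex ℝ K ∧ K ⊆ Metric.closedBall o r ∧ G.OneSided ∅ K ∧ ∃ z,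
      CornerPath (fun z => G.IsCorner φ m ∅ z ∧ z.pt ∈ K) (G.IsSide φ m small ∅) z z Set.univ := by
  refine ⟨Metric.closedBall o r, convex_closedBall o r, subset_rfl,
    fun _ _ _ h => absurd h (Set.notMem_empty _), ?_⟩
  obtain ⟨p, -, hp⟩ := Set.exists_min_image (Set.univ : Set V) id (Set.toFinite _) Set.univ_nonempty
  let z : V → Corner V := fun v => ⟨G.pos v, v, {v}⟩
  have hz : ∀ v, G.IsCorner φ m ∅ (z v) ∧ (z v).pt ∈ Metric.closedBall o r := fun v =>
    ⟨⟨fun x y hxy hx hy => mul_self_pos.2 (H.ccw.orient_ne_zero hxy.ne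
      (fun h => hx h.symm) (fun h => hy h.symm)), Or.inl ⟨rfl, rfl⟩⟩, H.pos_mem_closedBall v⟩
  -- The path visits the vertices from `q` upwards and then returns to the least vertex `p`;
  -- induction runs downwards from the greatest vertex.
  have key : ∀ q, CornerPath (fun z => G.IsCorner φ m ∅ z ∧ z.pt ∈ Metric.closedBall o r)
      (G.IsSide φ m small ∅) (z q) (z p) (Set.Ici q) := by
    intro q
    induction q using WellFoundedGT.induction with
    | ind q ih =>
      by_cases hq : (Set.Ioi q).Nonempty
      · obtain ⟨s, hs, hmin⟩ := Set.exists_min_image _ id (Set.toFinite _) hq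
        have hIco : Set.Ico q s = {q} := by
          ext x
          simp only [Set.mem_Ico, Set.mem_singleton_iff]
          refine ⟨fun hx => ?_, ?_⟩
          · by_contra hne
            exact (hmin x (lt_of_le_of_ne hx.1 (Ne.symm hne))).not_gt hx.2
          · rintro rfl
            exact ⟨le_rfl, hs⟩
        have hside : G.IsSide φ m small ∅ (z q) (z s) {q} := by
          refine ⟨H.subsingleton _ Set.subsingleton_singleton, Or.inl ⟨le_of_lt hs, hIco.symm⟩,
            Or.inl fun v w _ => H.ccw.orient_mul_nonneg (Or.inl ⟨fun x => ?_, le_of_lt hs⟩)⟩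
          rcases le_or_gt x q with h | h
          · exact Or.inl h
          · exact Or.inr (hmin x h)
        have hd : Disjoint {q} (Set.Ici s) := Set.disjoint_singleton_left.2 fun h => h.not_gt hs
        have := CornerPath.cons (hz q) hside (ih s hs) hd
        rwa [← hIco, Set.Ico_union_Ici_eq_Ici (le_of_lt hs)] at this
      · have hmax : ∀ x, x ≤ q := fun x => by
          by_contra! h
          exact hq ⟨x, h⟩
        have hIci : Set.Ici q = {q} := by
          ext x
          exact ⟨fun h => le_antisymm (hmax x) h, fun h => ge_of_eq h⟩
        rw [hIci]
        refine .single (hz q) (hz p) ⟨H.subsingleton _ Set.subsingleton_singleton,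
          Or.inr ⟨hp q trivial, ?_⟩, Or.inl fun v w _ => ?_⟩
        · ext x
          simp only [Set.mem_singleton_iff, Set.mem_compl_iff, Set.mem_Ico, not_and, not_lt]
          exact ⟨fun h _ => h ▸ le_rfl, fun h => le_antisymm (hmax x) (h (hp x trivial))⟩
        · rw [mul_comm]
          exact H.ccw.orient_mul_nonneg (Or.inr fun x => ⟨hp x trivial, hmax x⟩)
  refine ⟨z p, ?_⟩
  have := key p
  have hIci : Set.Ici p = Set.univ := by
    ext x; simpa using hp x trivial
  rwa [hIci] at this

/-- Choosing an undrawn edge of least colour ensures that all edges of smaller colour are already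
drawn, and that no drawn edge has a larger colour. -/
theorem exists_polygon_of_le [Nonempty V] (n : ℕ) (hn : n ≤ Nat.card G.graph.edgeSet) :
    ∃ E : Set G.graph.edgeSet, E.ncard = n ∧ (∀ f ∈ E, ∀ g ∉ E, φ f ≤ φ g) ∧
      ∃ K, Convex ℝ K ∧ K ⊆ Metric.closedBall o r ∧ G.OneSided E K ∧ ∃ z,
        CornerPath (fun z => G.IsCorner φ m E z ∧ z.pt ∈ K) (G.IsSide φ m small E) z z
          Set.univ := by
  have hfin : Finite G.graph.edgeSet := Subtype.finite
  induction n with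
  | zero => exact ⟨∅, by simp, fun f hf => absurd hf (Set.notMem_empty _), H.exists_polygon_empty⟩
  | succ n ih =>
    obtain ⟨E, hcard, hE, hpoly⟩ := ih (by omega)
    have hne : Eᶜ.Nonempty := by
      rw [Set.nonempty_compl]
      rintro rfl
      rw [Set.ncard_univ] at hcard
      omega
    obtain ⟨e, he, hmin⟩ := Set.exists_min_image _ φ (Set.toFinite _) hne
    refine ⟨insert e E, by rw [Set.ncard_insert_of_notMem he, hcard], ?_,
      H.exists_polygon_insert (fun f hf => hE f hf e he) hmin hpoly⟩
    rintro f hf g hg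
    rw [Set.mem_insert_iff, not_or] at hg
    rcases hf with rfl | hf
    · exact hmin g hg.2
    · exact hE f hf g hg.2

/-- A consistent notion of small sets cannot exist. -/
protected theorem false (hc : 1 ≤ c) : False := by
  rcases isEmpty_or_nonempty V with hV | hV
  · exact H.not_univ (H.subsingleton _ Set.subsingleton_of_subsingleton)
  have hfin : Finite G.graph.edgeSet := Subtype.finite
  obtain ⟨E, hcard, -, K, -, -, hK, z, hz⟩ := H.exists_polygon_of_le _ le_rfl
  have hE : E = Set.univ := by
    rw [← Set.ncard_univ] at hcard
    exact Set.eq_of_subset_of_ncard_le (Set.subset_univ _) hcard.ge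
  -- Sweeping round the polygon from `z`: the arc swept so far ends at two corners that no edge
  -- separates, so their two covers already cover its boundary.
  have key : ∀ {y A}, CornerPath (fun z => G.IsCorner φ m E z ∧ z.pt ∈ K)
      (G.IsSide φ m small E) y z A → ∀ B, small B → IsArc z.lab y.lab B → Disjoint B A →
      small (B ∪ A) := by
    intro y A hp
    have hzC := hp.right
    induction hp with
    | nil h => exact fun B hB _ _ => by simpa using hB
    | @cons a a' z A A' h1 h2 h3 h4 ih =>
      intro B hB harc hd
      rw [Set.disjoint_union_right] at hd
      have harc' := harc.union h2.2.1 hd.1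
      have ha' := h3.left
      rw [← Set.union_assoc]
      refine ih hz hzC _ (H.union _ _ hB h2.1 hd.1 (H.hasSmallBoundary hzC.1 ha'.1 harc' (S := ∅)
        ?_ fun v w hvw _ _ => hK v w hvw (hE ▸ Set.mem_univ _) _ hzC.2 _ ha'.2)) harc'
        (Set.disjoint_union_left.2 ⟨hd.2, h4⟩)
      by_cases hm : 0 < m
      · refine ncard_cov_union_le (hzC.1.ncard_cov_le hc) (ha'.1.ncard_cov_le hc) (y := 0)
          (by simp) ?_
        have := H.cost_le hm
        omega
      · exact ncard_cov_union_le (hzC.1.ncard_cov_le_one hm) (ha'.1.ncard_cov_le_one hm) (y := 0)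
          (by simp) H.two_le
  have := key hz ∅ (H.subsingleton _ Set.subsingleton_empty) (isArc_empty _) (Set.empty_disjoint _)
  rw [Set.empty_union] at this
  exact H.not_univ this
end

end IsSmallSetting

/-! ### Assembling the bound -/

/-- The treewidth bound under the fragment hypothesis. -/
theorem treewidth_le [Finite V] (hG : G.IsCircular) (hc : 1 ≤ c) (hφ : G.IsTransparent φ)
    (hm : ∀ i j : Fin c, i < j → ∀ e : G.graph.edgeSet, φ e = i →
      ∀ γ : Set Plane, G.IsFragment φ e γ →
        matchingNumber {f : G.graph.edgeSet | φ f = j ∧ G.CrossesFragment f e γ} ≤ m) :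
    treewidth G.graph ≤ 9 * (m : ℤ) * c * (c - 1) + 3 * c - 1 := by
  obtain ⟨o, r, hr, hs⟩ := hG
  obtain ⟨_, hccw⟩ := exists_linearOrder_isCounterclockwise G.pos_injective hr hs
  -- One colour is separate: there `k` would be `1`, too small for the covers of two corners.
  rcases hc.lt_or_eq with hc2 | rfl
  · obtain ⟨d, rfl⟩ := Nat.exists_eq_add_of_le' hc
    set k := 3 * m * (d + 1) * d + (d + 1) with hk
    have hb : Buildable G.graph k {A | A.Subsingleton} Set.univ := by
      by_contra hb
      obtain ⟨small, h1, h2, h3, h4⟩ := exists_small_sets (by omega) hb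
      refine IsSmallSetting.false (G := G) (φ := φ) (m := m) (k := k) (o := o) (r := r)
        (small := small) ⟨hs, hccw, hφ, hm, by omega, fun hm0 => ?_, h1, h2, h3, h4⟩ hc
      rw [pathCost_self, hk, Nat.add_sub_cancel]
      -- With `c = d + 1`, the inequality `2c + 2mc(c-1) ≤ k` amounts to `c ≤ mc(c-1)`.
      have hd : 1 ≤ m * d := Nat.mul_pos hm0 (by omega)
      nlinarith
    have := hb.treewidth_le (by omega)
    refine this.trans (le_of_eq ?_)
    rw [hk]
    push_cast
    ring
  · refine (treewidth_le_two_of_noncrossing fun a b x d hab hbx hxd hax hbd => ?_).trans ?_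
    · exact hφ _ _ (Subsingleton.elim _ _) (G.crosses_of_lt hs hccw hab hbx hxd hax hbd)
    · norm_num

end GeometricGraph

theorem matchingNumber_mono {V : Type*} {G : SimpleGraph V} {E F : Set G.edgeSet} (h : E ⊆ F) :
    matchingNumber E ≤ matchingNumber F :=
  iSup₂_le fun M hM => le_iSup₂ (f := fun (M : Set G.edgeSet) (_ : M ⊆ F ∧ IsEdgeMatching M) =>
    M.encard) M ⟨hM.1.trans h, hM.2⟩

theorem mainTheorem4 {V : Type*} [Finite V] (G : GeometricGraph V) (hG : G.IsCircular)
    (c m : ℕ) (hc : 1 ≤ c) (φ : G.graph.edgeSet → Fin c) (hφ : G.IsTransparent φ) :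
    ((∀ i j : Fin c, i < j → ∀ e : G.graph.edgeSet, φ e = i →
        ∀ γ : Set Plane, G.IsFragment φ e γ →
          matchingNumber {f : G.graph.edgeSet | φ f = j ∧ G.CrossesFragment f e γ} ≤ m) →
      treewidth G.graph ≤ 9 * (m : ℤ) * c * (c - 1) + 3 * c - 1) ∧
    ((∀ i j : Fin c, i < j → ∀ e : G.graph.edgeSet, φ e = i →
          matchingNumber {f : G.graph.edgeSet | φ f = j ∧ G.Crosses f e} ≤ m) →
      treewidth G.graph ≤ 9 * (m : ℤ) * c * (c - 1) + 3 * c - 1) := by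
  refine ⟨G.treewidth_le hG hc hφ, fun h => G.treewidth_le hG hc hφ fun i j hij e he γ _ =>
    (matchingNumber_mono ?_).trans (h i j hij e he)⟩
  rintro f ⟨hf, x, hx, -⟩
  exact ⟨hf, G.crosses_comm ⟨x, hx⟩⟩
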